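/- Let $E$ be a real uniformly smooth and 2-uniformly convex Banach space with dual $E^*$, where 2-uniform convexity means that, for some $\kappa>0$, the modulus of convexity $\delta_E(\epsilon)=\inf\{1-\|x+y\|/2:\|x\|=\|y\|=1,\ \|x-y\|=\epsilon\}$ (with $\inf\emptyset=+\infty$) satisfies $\delta_E(\epsilon)\ge\kappa\epsilon^2$ for all $\epsilon\in[0,2]$. Let $J:E\to E^*$ be the normalized duality mapping, $\langle Jx,x\rangle=\|x\|^2=\|Jx\|^2$, and let $\phi(x,y)=\|x\|^2-2\langle x,Jy\rangle+\|y\|^2$. For $D\subset E$ put $\Pi_D(x)=\arg\min_{y\in D}\phi(y,x)$. Let $c$ be the largest number in $(0,1]$ such that $\|x-y\|\le\frac{2}{c^2}\|Jx-Jy\|$ for all $x,y\in E$ ($1/c$ is the 2-uniform convexity constant of $E$). Let $C\subset E$ be nonempty, closed and convex, let $M,N,K\ge1$ be integers, and assume the following. (V) $A_1,\dots,A_M:C\to E^*$, and there is $\alpha>0$ such that for every $i$: $\langle A_ix-A_iy,x-y\rangle\ge\alpha\|A_ix-A_iy\|^2$ for all $x,y\in C$; the set $VI(A_i,C)=\{p\in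 C:\langle A_ip,q-p\rangle\ge0\ \forall q\in C\}$ is nonempty; and $\|A_iy\|\le\|A_iy-A_iu\|$ for all $y\in C$, $u\in VI(A_i,C)$. (A) $f_1,\dots,f_K:C\times C\to\mathbb R$ satisfy, for all $x,y,z\in C$: $f_k(x,x)=0$; $f_k(x,y)+f_k(y,x)\le0$; $\limsup_{t\to0^+}f_k(tz+(1-t)x,y)\le f_k(x,y)$; and $f_k(x,\cdot)$ is convex and lower semicontinuous on $C$. Put $EP(f_k)=\{p\in C:f_k(p,y)\ge0\ \forall y\in C\}$. For $r>0$ and $x\in E$, $T_r^kx$ denotes the solution $z\in C$ of $f_k(z,y)+\frac1r\langle y-z,Jz-Jx\rangle\ge0$ for all $y\in C$. (S) $S_1,\dots,S_N:C\to C$ have nonempty fixed point sets $F(S_j)$, and there are $L>0$ and a sequence $k_n\ge1$ with $k_n\to1$ such that for all $j$ and all $n\ge1$: $\|S_j^nx-S_j^ny\|\le L\|x-y\|$ for all $x,y\in C$, and $\phi(p,S_j^nx)\le k_n\phi(p,x)$ for all $p\in F(S_j)$, $x\in C$. Assume that $F=\bigcap_{i}VI(A_i,C)\cap\bigcap_{j}F(S_j)\cap\bigcap_{k}EP(f_k)$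 is nonempty and that $\|u\|\le\omega$ for all $u\in F$, for some $\omega>0$. Let $0\le\alpha_{n,j}\le1$, $\sum_{j=0}^N\alpha_{n,j}=1$, $\liminf_{n\to\infty}\alpha_{n,0}\alpha_{n,j}>0$ for $j=1,\dots,N$, $\lambda_n\in[a,b]$ with $a,b\in(0,\alpha c^2/2)$, and $r_n\ge d>0$. Method B: given $x_0\in C$, put $C_0=C$ and, for $n=0,1,2,\dots$, with $\epsilon_n=(k_n-1)(\omega+\|x_n\|)^2$, $$\begin{aligned} &y_n^i=\Pi_C\big(J^{-1}(Jx_n-\lambda_nA_ix_n)\big),\quad i=1,\dots,M,\\ &i_n\in\arg\max_{1\le i\le M}\|y_n^i-x_n\|,\quad \bar y_n=y_n^{i_n},\\ &z_n=J^{-1}\Big(\alpha_{n,0}Jx_n+\sum_{j=1}^N\alpha_{n,j}JS_j^n\bar y_n\Big),\\ &u_n^k=T_{r_n}^kz_n,\quad k=1,\dots,K,\\ &\kappa_n\in\arg\max_{1\le k\le K}\|u_n^k-x_n\|,\quad \bar u_n=u_n^{\kappa_n},\\ &C_{n+1}=\{v\in C_n:\phi(v,\bar u_n)\le\phi(v,x_n)+\epsilon_n\},\\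 &x_{n+1}=\Pi_{C_{n+1}}x_0 . \end{aligned}$$ Then, for every $x_0\in C$, the method is well defined (a sequence generated by it exists), the point $\Pi_Fx_0$ exists and is unique, and every sequence $(x_n)$ generated by the method converges strongly to $\Pi_Fx_0$. -/

import Mathlib

open Filter Topology Set

namespace HybridMethod

section Geometry

variable (E : Type*) [NormedAddCommGroup E]

/-- `E` is uniformly smooth: the limit of `(‖x + t y‖ - ‖x‖) / t` as `t → 0` exists uniformly for
`x, y` in the unit sphere. -/
def IsUniformlySmooth [NormedSpace ℝ E] : Prop :=
  ∃ D : E × E → ℝ, TendstoUniformlyOn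
    (fun (t : ℝ) (p : E × E) => (‖p.1 + t • p.2‖ - ‖p.1‖) / t) D (𝓝[≠] 0)
    (Metric.sphere (0 : E) 1 ×ˢ Metric.sphere (0 : E) 1)

/-- The modulus of convexity of `E`. It takes values in `EReal`, so that the infimum of the empty
set (which occurs when `dim E ≤ 1`) is `⊤`. -/
noncomputable def modulusOfConvexity (ε : ℝ) : EReal :=
  ⨅ p : {p : E × E // ‖p.1‖ = 1 ∧ ‖p.2‖ = 1 ∧ ‖p.1 - p.2‖ = ε},
    ((1 - ‖p.1.1 + p.1.2‖ / 2 : ℝ) : EReal)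

/-- `E` is 2-uniformly convex: `δ_E(ε) ≥ κ ε ^ 2` on `[0, 2]` for some `κ > 0`. -/
def IsTwoUniformlyConvex : Prop :=
  ∃ κ : ℝ, 0 < κ ∧ ∀ ε ∈ Icc (0 : ℝ) 2, ((κ * ε ^ 2 : ℝ) : EReal) ≤ modulusOfConvexity E ε

theorem isTwoUniformlyConvex_iff :
    IsTwoUniformlyConvex E ↔ ∃ κ : ℝ, 0 < κ ∧ ∀ x y : E, ‖x‖ = 1 → ‖y‖ = 1 →
      κ * ‖x - y‖ ^ 2 ≤ 1 - ‖x + y‖ / 2 := by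
  constructor
  · rintro ⟨κ, hκ, h⟩
    refine ⟨κ, hκ, fun x y hx hy => ?_⟩
    have h2 : ‖x - y‖ ≤ 2 := by
      have := norm_sub_le x y
      linarith
    have h3 := (h ‖x - y‖ ⟨norm_nonneg _, h2⟩).trans
      (iInf_le _ (⟨(x, y), hx, hy, rfl⟩ :
        {p : E × E // ‖p.1‖ = 1 ∧ ‖p.2‖ = 1 ∧ ‖p.1 - p.2‖ = ‖x - y‖}))
    exact EReal.coe_le_coe_iff.1 h3
  · rintro ⟨κ, hκ, h⟩
    refine ⟨κ, hκ, fun ε _ => le_iInf ?_⟩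
    rintro ⟨⟨x, y⟩, hx, hy, rfl⟩
    exact EReal.coe_le_coe_iff.2 (h x y hx hy)

end Geometry

section Duality

variable {E : Type*} [NormedAddCommGroup E] [NormedSpace ℝ E]

/-- The normalized duality mapping, as a set-valued map `E → 2^{E*}`. -/
def dualitySet (x : E) : Set (StrongDual ℝ E) :=
  {g | g x = ‖x‖ ^ 2 ∧ ‖g‖ ^ 2 = ‖x‖ ^ 2}

theorem dualitySet_nonempty (x : E) : (dualitySet x).Nonempty := by
  by_cases hx : x = 0
  · exact ⟨0, by simp [dualitySet, hx]⟩
  · obtain ⟨g, hg, hgx⟩ := exists_dual_vector ℝ x (norm_ne_zero_iff.2 hx)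
    refine ⟨‖x‖ • g, ?_, ?_⟩
    · simp [hgx, pow_two]
    · simp [norm_smul, hg]

/-- The normalized duality mapping as a function. In a smooth space, in particular in a uniformly
smooth one, `dualitySet x` is a singleton, so that nothing is chosen. -/
noncomputable def J (x : E) : StrongDual ℝ E := (dualitySet_nonempty x).some

theorem J_mem (x : E) : J x ∈ dualitySet x := (dualitySet_nonempty x).some_mem

variable (E) in
/-- The largest `c ∈ (0, 1]` with `‖x - y‖ ≤ (2 / c ^ 2) ‖J x - J y‖` for all `x, y`; the best
constant `1 / c` is called the 2-uniform convexity constant of `E`. (In a 2-uniformly convex space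
such `c` exist; the condition is closed in `c`, so that the supremum is attained.) -/
noncomputable def convexityParameter : ℝ :=
  sSup {c : ℝ | 0 < c ∧ c ≤ 1 ∧ ∀ x y : E, ‖x - y‖ ≤ 2 / c ^ 2 * ‖J x - J y‖}

/-- The Lyapunov functional `φ(x, y) = ‖x‖² - 2⟨x, J y⟩ + ‖y‖²`. -/
noncomputable def phi (x y : E) : ℝ := ‖x‖ ^ 2 - 2 * J y x + ‖y‖ ^ 2

/-- `p` is a generalized projection of `x` onto `D`, that is, `p ∈ argmin_{q ∈ D} φ(q, x)`. -/
def IsGenProj (D : Set E) (x p : E) : Prop := p ∈ D ∧ ∀ q ∈ D, phi p x ≤ phi q x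

/-- The solution set `VI(A, C)` of the variational inequality. -/
def VI (A : E → StrongDual ℝ E) (C : Set E) : Set E := {p | p ∈ C ∧ ∀ q ∈ C, 0 ≤ A p (q - p)}

/-- The solution set `EP(f)` of the equilibrium problem on `C`. -/
def EP (f : E → E → ℝ) (C : Set E) : Set E := {p | p ∈ C ∧ ∀ q ∈ C, 0 ≤ f p q}

/-- The fixed points of a mapping `S : C → C`. -/
def Fix (S : E → E) (C : Set E) : Set E := {p | p ∈ C ∧ S p = p}

/-- Conditions (V1)-(V3) on a mapping `A` of `C` into the dual. -/
structure CondV (A : E → StrongDual ℝ E) (C : Set E) (α : ℝ) : Prop where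
  ism : ∀ x ∈ C, ∀ y ∈ C, α * ‖A x - A y‖ ^ 2 ≤ (A x - A y) (x - y)
  nonempty : (VI A C).Nonempty
  bound : ∀ y ∈ C, ∀ u ∈ VI A C, ‖A y‖ ≤ ‖A y - A u‖

/-- Conditions (A1)-(A4) on a bifunction `f : C × C → ℝ`. -/
structure CondA (f : E → E → ℝ) (C : Set E) : Prop where
  diag : ∀ x ∈ C, f x x = 0
  monotone : ∀ x ∈ C, ∀ y ∈ C, f x y + f y x ≤ 0
  limsup_le : ∀ x ∈ C, ∀ y ∈ C, ∀ z ∈ C,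
    limsup (fun t : ℝ => ((f (t • z + (1 - t) • x) y : ℝ) : EReal)) (𝓝[>] 0) ≤ (f x y : EReal)
  convex : ∀ x ∈ C, ConvexOn ℝ C (f x)
  lsc : ∀ x ∈ C, LowerSemicontinuousOn (f x) C

/-- `S : C → C` is quasi `φ`-asymptotically nonexpansive with the sequence `k`. -/
structure QuasiPhiAsymptoticallyNonexpansive (S : E → E) (C : Set E) (k : ℕ → ℝ) : Prop where
  mapsTo : MapsTo S C C
  nonempty : (Fix S C).Nonempty
  one_le : ∀ n, 1 ≤ k n
  tendsto : Tendsto k atTop (𝓝 1)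
  phi_le : ∀ n, 1 ≤ n → ∀ p ∈ Fix S C, ∀ x ∈ C, phi p (S^[n] x) ≤ k n * phi p x

/-- `S : C → C` is uniformly `L`-Lipschitz continuous. -/
def UniformlyLipschitz (S : E → E) (C : Set E) (L : ℝ) : Prop :=
  ∀ n, 1 ≤ n → ∀ x ∈ C, ∀ y ∈ C, ‖S^[n] x - S^[n] y‖ ≤ L * ‖x - y‖

/-- `z = T_r x`: the point `z` solves the equilibrium problem for `f` on `C`, regularized with the
parameter `r` at `x`. -/
def IsResolvent (f : E → E → ℝ) (C : Set E) (r : ℝ) (x z : E) : Prop :=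
  z ∈ C ∧ ∀ y ∈ C, 0 ≤ f z y + 1 / r * (J z - J x) (y - z)

/-- The set of common solutions. -/
def commonSolutions {M N K : ℕ} (C : Set E) (A : Fin M → E → StrongDual ℝ E) (S : Fin N → E → E)
    (f : Fin K → E → E → ℝ) : Set E :=
  (⋂ i, VI (A i) C) ∩ (⋂ j, Fix (S j) C) ∩ ⋂ k, EP (f k) C

/-- `x`, together with the auxiliary points `y n i`, `z n`, `u n k`, the indices `iMax n`, `kMax n`
and the sets `D n` (written `C_n` on paper), is produced by Method B from the initial point `x₀`.
The weight of `J x_n` is `w n 0`, and that of `J S_j^n y_n` is `w n j.succ`. -/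
structure IsMethodBRun {M N K : ℕ} (C : Set E) (A : Fin M → E → StrongDual ℝ E)
    (S : Fin N → E → E) (f : Fin K → E → E → ℝ) (kn : ℕ → ℝ) (ω : ℝ) (lam r : ℕ → ℝ)
    (w : ℕ → Fin (N + 1) → ℝ) (x₀ : E)
    (x : ℕ → E) (y : ℕ → Fin M → E) (iMax : ℕ → Fin M) (z : ℕ → E) (u : ℕ → Fin K → E)
    (kMax : ℕ → Fin K) (D : ℕ → Set E) : Prop where
  x_zero : x 0 = x₀
  D_zero : D 0 = C
  y_eq : ∀ n i, ∃ v, J v = J (x n) - lam n • A i (x n) ∧ IsGenProj C v (y n i)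
  iMax_max : ∀ n i, ‖y n i - x n‖ ≤ ‖y n (iMax n) - x n‖
  z_eq : ∀ n, J (z n) = w n 0 • J (x n) + ∑ j : Fin N, w n j.succ • J ((S j)^[n] (y n (iMax n)))
  u_eq : ∀ n k, IsResolvent (f k) C (r n) (z n) (u n k)
  kMax_max : ∀ n k, ‖u n k - x n‖ ≤ ‖u n (kMax n) - x n‖
  D_succ : ∀ n, D (n + 1) =
    {v ∈ D n | phi v (u n (kMax n)) ≤ phi v (x n) + (kn n - 1) * (ω + ‖x n‖) ^ 2}
  x_succ : ∀ n, IsGenProj (D (n + 1)) x₀ (x (n + 1))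

/-- `x` is a sequence generated by Method B from the initial point `x₀`. -/
def GeneratedByMethodB {M N K : ℕ} (C : Set E) (A : Fin M → E → StrongDual ℝ E)
    (S : Fin N → E → E) (f : Fin K → E → E → ℝ) (kn : ℕ → ℝ) (ω : ℝ) (lam r : ℕ → ℝ)
    (w : ℕ → Fin (N + 1) → ℝ) (x₀ : E) (x : ℕ → E) : Prop :=
  ∃ (y : ℕ → Fin M → E) (iMax : ℕ → Fin M) (z : ℕ → E) (u : ℕ → Fin K → E) (kMax : ℕ → Fin K)
    (D : ℕ → Set E), IsMethodBRun C A S f kn ω lam r w x₀ x y iMax z u kMax D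

end Duality

end HybridMethod

open HybridMethod

/-!
# Strong convergence of a parallel hybrid method in 2-uniformly convex spaces

Everything rests on the Lyapunov functional `φ`. In a 2-uniformly convex space it dominates the
squared distance, `μ ‖x - y‖² ≤ φ(x, y)` (`exists_mul_sq_le_phi`), and in a uniformly smooth space
the duality mapping `J` is single-valued and continuous (`continuous_J`), so that `φ` is continuous.
Hence, if one of two sequences converges, the other has the same limit exactly when `φ` between them
tends to zero, and it is enough to control `φ` throughout.

*The method is well defined.* The functionals `‖·‖² - 2 g` are strongly midpoint convex, so they
attain their minimum over closed convex sets by completeness alone (`exists_minimizer`). This gives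
the generalized projections and the surjectivity of `J` (`J_surjective`). The regularized equilibrium
problem that defines the resolvent is strongly monotone. A theorem of the alternative for finitely
many convex functions, which is Hahn-Banach separation in a finite-dimensional space, yields
approximate solutions of its Minty form for finitely many test points; strong monotonicity keeps them
in a fixed ball, and closed convex sets in a ball with the finite intersection property have a common
point (`exists_forall_mem_of_finite_inter`). Minty's lemma then gives `exists_isResolvent`.

*Convergence.* Every step satisfies a Lyapunov balance relative to a common solution `p`
(`IsStep.phi_estimate`): `φ(p, ū_n)` plus several nonnegative terms is at most `φ(p, x_n) + ε_n`. Thus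
the common solutions stay in all the sets `C_n`, which are closed and convex because their defining
inequalities are affine. The iterates are projections of `x₀` onto decreasing sets, so they form a
Cauchy sequence whose limit is the projection of `x₀` onto `⋂ C_n` (`IsMethodBRun.exists_tendsto`). The
nonnegative terms in the balance then tend to zero, which forces every auxiliary sequence to the same
limit, and the limit is a common solution (`IsMethodBRun.limit_mem_commonSolutions`). The averaging
step needs no convexity of the dual norm, since `∑ w_j φ(p, s_j) - φ(p, z) = ∑ w_j φ(z, s_j)` holds
exactly when `J z = ∑ w_j J s_j` (`sum_phi_eq`). Finally, the projection onto `⋂ C_n` is unique and the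
common solutions lie in this convex set; so the limit is the only projection of `x₀` onto them.
-/

namespace HybridMethod

section Geometry

variable {E : Type*} [NormedAddCommGroup E] [NormedSpace ℝ E]

/-! ### The Lyapunov functional -/

theorem J_apply_self (x : E) : J x x = ‖x‖ ^ 2 := (J_mem x).1

theorem norm_J (x : E) : ‖J x‖ = ‖x‖ :=
  (pow_left_inj₀ (norm_nonneg _) (norm_nonneg _) two_ne_zero).1 (J_mem x).2

theorem abs_J_apply_le (y x : E) : |J y x| ≤ ‖y‖ * ‖x‖ := by
  have := (J y).le_opNorm x
  rwa [norm_J, Real.norm_eq_abs] at this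

theorem phi_self (x : E) : phi x x = 0 := by
  rw [phi, J_apply_self]; ring

theorem phi_nonneg (x y : E) : 0 ≤ phi x y := by
  have h := (abs_le.1 (abs_J_apply_le y x)).2
  rw [phi]
  nlinarith [sq_nonneg (‖x‖ - ‖y‖)]

theorem phi_le_sq_add (x y : E) : phi x y ≤ (‖x‖ + ‖y‖) ^ 2 := by
  have h := (abs_le.1 (abs_J_apply_le y x)).1
  rw [phi]
  nlinarith

theorem phi_three_point (q y v : E) :
    phi q v = phi q y + phi y v + 2 * (J y - J v) (q - y) := by
  simp only [phi, sub_apply, map_sub, J_apply_self]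
  ring

theorem phi_add_phi_swap (x y : E) : phi x y + phi y x = 2 * (J x - J y) (x - y) := by
  simp only [phi, sub_apply, map_sub, J_apply_self]
  ring

theorem J_monotone (x y : E) : 0 ≤ (J x - J y) (x - y) := by
  linarith [phi_add_phi_swap x y, phi_nonneg x y, phi_nonneg y x]

/-- The weighted Lyapunov distances to the points `s j` exceed the Lyapunov distance to the
`J`-average `z` of these points exactly by the weighted distances from `z`. -/
theorem sum_phi_eq {ι : Type*} [Fintype ι] (w : ι → ℝ) (hw : ∑ j, w j = 1) (s : ι → E) (p z : E)
    (hz : J z = ∑ j, w j • J (s j)) :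
    ∑ j, w j * phi p (s j) = phi p z + ∑ j, w j * phi z (s j) := by
  have key : ∀ j, w j * phi p (s j) - w j * phi z (s j)
      = w j * phi p z + 2 * (w j * J z (p - z)) - 2 * (w j • J (s j)) (p - z) := by
    intro j
    rw [phi_three_point p z (s j)]
    simp only [sub_apply, smul_apply, smul_eq_mul]
    ring
  have h := Finset.sum_congr (rfl : Finset.univ = Finset.univ) fun j _ => key j
  rw [Finset.sum_sub_distrib, Finset.sum_sub_distrib, Finset.sum_add_distrib, ← Finset.mul_sum,
    ← Finset.mul_sum, ← Finset.sum_mul, ← Finset.sum_mul, hw, ← sum_apply, ← hz] at h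
  linarith

/-! ### Lower bound on the Lyapunov functional -/

/-- In a 2-uniformly convex space the Lyapunov functional dominates the squared distance. For
`x = s x'` and `y = t y'` with unit vectors `x'`, `y'` one has
`φ(x, y) = (s - t)² + 2 s t (1 - ⟨x', J y'⟩)`, and the last bracket is controlled by the modulus
of convexity because `1 + ⟨x', J y'⟩ ≤ ‖x' + y'‖`. -/
theorem exists_mul_sq_le_phi (hconv : IsTwoUniformlyConvex E) :
    ∃ μ : ℝ, 0 < μ ∧ ∀ x y : E, μ * ‖x - y‖ ^ 2 ≤ phi x y := by
  obtain ⟨κ, hκ, h⟩ := (isTwoUniformlyConvex_iff E).1 hconv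
  refine ⟨min (1 / 2) (2 * κ), by positivity, fun x y => ?_⟩
  set μ := min (1 / 2) (2 * κ) with hμ
  have hμ0 : 0 < μ := by positivity
  have hμ1 : μ ≤ 1 / 2 := min_le_left _ _
  have hμ2 : μ ≤ 2 * κ := min_le_right _ _
  by_cases hx : x = 0
  · subst hx; simp only [zero_sub, norm_neg, phi, norm_zero, map_zero]
    nlinarith [sq_nonneg ‖y‖]
  by_cases hy : y = 0
  · subst hy
    have : J (0 : E) = 0 := norm_eq_zero.1 (by rw [norm_J, norm_zero])
    simp only [sub_zero, phi, norm_zero, this, zero_apply]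
    nlinarith [sq_nonneg ‖x‖]
  have hs : 0 < ‖x‖ := norm_pos_iff.2 hx
  have ht : 0 < ‖y‖ := norm_pos_iff.2 hy
  set s := ‖x‖ with hs'
  set t := ‖y‖ with ht'
  obtain ⟨x', hx'⟩ : ∃ x', x' = s⁻¹ • x := ⟨_, rfl⟩
  obtain ⟨y', hy'⟩ : ∃ y', y' = t⁻¹ • y := ⟨_, rfl⟩
  have nx : ‖x'‖ = 1 := by
    rw [hx', norm_smul, norm_inv, Real.norm_of_nonneg hs.le, ← hs', inv_mul_cancel₀ hs.ne']
  have ny : ‖y'‖ = 1 := by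
    rw [hy', norm_smul, norm_inv, Real.norm_of_nonneg ht.le, ← ht', inv_mul_cancel₀ ht.ne']
  have ex : x = s • x' := by rw [hx', smul_inv_smul₀ hs.ne']
  have ey : y = t • y' := by rw [hy', smul_inv_smul₀ ht.ne']
  have hk := h x' y' nx ny
  set e := ‖x' - y'‖
  -- the supporting functional at `y` bounds the pairing
  have hJ : J y x ≤ s * t * (1 - 2 * κ * e ^ 2) := by
    have h1 : J y (x' + y') ≤ t * ‖x' + y'‖ :=
      (le_abs_self _).trans (abs_J_apply_le y _)
    have h2 : J y y' = t := by
      rw [hy', map_smul, J_apply_self, smul_eq_mul, ← ht']; field_simp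
    rw [map_add, h2] at h1
    have h3 : J y x' ≤ t * (1 - 2 * κ * e ^ 2) := by nlinarith
    have h4 : J y x = s * J y x' := by
      conv_lhs => rw [ex, map_smul, smul_eq_mul]
    rw [h4]; nlinarith
  have hphi : (s - t) ^ 2 + 4 * κ * (s * t) * e ^ 2 ≤ phi x y := by
    rw [phi]; nlinarith
  have hd : ‖x - y‖ ^ 2 ≤ 2 * (s - t) ^ 2 + 2 * (s * t) * e ^ 2 := by
    have he : 0 ≤ e := norm_nonneg _
    have main : ∀ m : ℝ, 0 ≤ m → m ^ 2 ≤ s * t → ‖x - y‖ ≤ |s - t| + m * e →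
        ‖x - y‖ ^ 2 ≤ 2 * (s - t) ^ 2 + 2 * (s * t) * e ^ 2 := by
      intro m hm hmst hle
      have h1 : ‖x - y‖ ^ 2 ≤ (|s - t| + m * e) ^ 2 := by gcongr
      have h2 : m ^ 2 * e ^ 2 ≤ s * t * e ^ 2 := by gcongr
      nlinarith [sq_abs (s - t), sq_nonneg (|s - t| - m * e)]
    rcases le_total s t with hst | hst
    · refine main s hs.le (by nlinarith) ?_
      have : x - y = (s - t) • y' + s • (x' - y') := by
        rw [smul_sub, sub_smul, ← ex, ← ey]; abel
      rw [this]
      refine (norm_add_le _ _).trans ?_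
      rw [norm_smul, norm_smul, ny, mul_one, Real.norm_eq_abs, Real.norm_of_nonneg hs.le]
    · refine main t ht.le (by nlinarith) ?_
      have : x - y = (s - t) • x' + t • (x' - y') := by
        rw [smul_sub, sub_smul, ← ex, ← ey]; abel
      rw [this]
      refine (norm_add_le _ _).trans ?_
      rw [norm_smul, norm_smul, nx, mul_one, Real.norm_eq_abs, Real.norm_of_nonneg ht.le]
  have hst : 0 ≤ s * t * e ^ 2 := by positivity
  calc μ * ‖x - y‖ ^ 2 ≤ μ * (2 * (s - t) ^ 2 + 2 * (s * t) * e ^ 2) := by gcongr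
    _ ≤ (s - t) ^ 2 + 4 * κ * (s * t) * e ^ 2 := by nlinarith [sq_nonneg (s - t)]
    _ ≤ phi x y := hphi

/-- The supremum that defines `convexityParameter E` is attained. -/
theorem convexityParameter_spec (hconv : IsTwoUniformlyConvex E) :
    0 < convexityParameter E ∧
      ∀ x y : E, ‖x - y‖ ≤ 2 / convexityParameter E ^ 2 * ‖J x - J y‖ := by
  obtain ⟨μ, hμ, hφ⟩ := exists_mul_sq_le_phi hconv
  set T : Set ℝ := {c : ℝ | 0 < c ∧ c ≤ 1 ∧ ∀ x y : E, ‖x - y‖ ≤ 2 / c ^ 2 * ‖J x - J y‖} with hT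
  have hmem : min 1 (√(2 * μ)) ∈ T := by
    have hpos : 0 < min 1 (√(2 * μ)) := lt_min one_pos (Real.sqrt_pos.2 (by positivity))
    refine ⟨hpos, min_le_left _ _, fun x y => ?_⟩
    have hsq : min 1 (√(2 * μ)) ^ 2 ≤ 2 * μ := by
      calc min 1 (√(2 * μ)) ^ 2 ≤ √(2 * μ) ^ 2 := by gcongr; exact min_le_right _ _
        _ = 2 * μ := Real.sq_sqrt (by positivity)
    have h1 : μ * ‖x - y‖ ^ 2 ≤ ‖J x - J y‖ * ‖x - y‖ := by
      have h2 := phi_add_phi_swap x y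
      have h3 := hφ x y
      have h4 := hφ y x
      rw [norm_sub_rev] at h4
      have h5 := (le_abs_self _).trans ((J x - J y).le_opNorm (x - y))
      linarith
    have h6 : μ * ‖x - y‖ ≤ ‖J x - J y‖ := by
      rcases (norm_nonneg (x - y)).eq_or_lt with h0 | h0
      · rw [← h0, mul_zero]; exact norm_nonneg _
      · nlinarith
    rw [div_mul_eq_mul_div, le_div_iff₀ (by positivity)]
    nlinarith [norm_nonneg (x - y)]
  have hbdd : BddAbove T := ⟨1, fun c hc => hc.2.1⟩
  have hpos : 0 < sSup T := hmem.1.trans_le (le_csSup hbdd hmem)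
  refine ⟨hpos, fun x y => ?_⟩
  change ‖x - y‖ ≤ 2 / sSup T ^ 2 * ‖J x - J y‖
  obtain ⟨c, -, -, hc, hcT⟩ := (isLUB_csSup ⟨_, hmem⟩ hbdd).exists_seq_monotone_tendsto ⟨_, hmem⟩
  have hlim : Tendsto (fun n => 2 / c n ^ 2 * ‖J x - J y‖) atTop
      (𝓝 (2 / sSup T ^ 2 * ‖J x - J y‖)) :=
    ((tendsto_const_nhds.div (hc.pow 2) (by positivity)).mul_const _)
  exact ge_of_tendsto' hlim fun n => (hcT n).2.2 x y

/-! ### The duality mapping of a uniformly smooth space -/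

theorem smul_mem_dualitySet {x : E} {g : StrongDual ℝ E} (hg : g ∈ dualitySet x) (t : ℝ) :
    t • g ∈ dualitySet (t • x) := by
  refine ⟨?_, ?_⟩
  · simp only [smul_apply, map_smul, smul_eq_mul, hg.1, norm_smul, Real.norm_eq_abs, mul_pow,
      sq_abs]
    ring
  · rw [norm_smul, norm_smul, mul_pow, mul_pow, hg.2]

/-- On the unit sphere of a uniformly smooth space, supporting functionals are approximated by
difference quotients of the norm, with an error that depends only on the step. -/
theorem exists_abs_sub_quotient_le (hs : IsUniformlySmooth E) {ε : ℝ} (hε : 0 < ε) :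
    ∃ t : ℝ, 0 < t ∧ ∀ x y : E, ‖x‖ = 1 → ‖y‖ = 1 → ∀ g ∈ dualitySet x,
      |g y - (‖x + t • y‖ - ‖x‖) / t| ≤ ε := by
  obtain ⟨D, hD⟩ := hs
  have h1 := Metric.tendstoUniformlyOn_iff.1 hD (ε / 2) (by positivity)
  rw [eventually_nhdsWithin_iff, Metric.eventually_nhds_iff] at h1
  obtain ⟨δ, hδ, h⟩ := h1
  have hδ2 : 0 < δ / 2 := by positivity
  refine ⟨δ / 2, hδ2, fun x y hx hy g hg => ?_⟩
  have hmem : (x, y) ∈ Metric.sphere (0 : E) 1 ×ˢ Metric.sphere (0 : E) 1 := by simp [hx, hy]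
  have hp := h (y := δ / 2) (by rw [Real.dist_eq, sub_zero, abs_of_pos hδ2]; linarith)
    hδ2.ne' _ hmem
  have hm := h (y := -(δ / 2)) (by rw [Real.dist_eq, sub_zero, abs_neg, abs_of_pos hδ2]; linarith)
    (neg_ne_zero.2 hδ2.ne') _ hmem
  set t := δ / 2
  rw [Real.dist_eq] at hp hm
  dsimp only at hp hm
  have hgn : ‖g‖ = 1 := by
    have := hg.2
    rw [hx] at this
    nlinarith [norm_nonneg g]
  have hgx : g x = 1 := by rw [hg.1, hx]; norm_num
  have hle : ∀ v : E, g v ≤ ‖v‖ := fun v => by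
    have := (le_abs_self _).trans (g.le_opNorm v)
    rwa [hgn, one_mul] at this
  have up : g y ≤ (‖x + t • y‖ - ‖x‖) / t := by
    rw [le_div_iff₀ hδ2, hx]
    have := hle (x + t • y)
    rw [map_add, map_smul, hgx, smul_eq_mul] at this
    linarith
  have lo : (‖x + -t • y‖ - ‖x‖) / -t ≤ g y := by
    rw [div_neg, neg_le, le_div_iff₀ hδ2, hx]
    have := hle (x + -t • y)
    rw [map_add, map_smul, hgx, smul_eq_mul] at this
    linarith
  rw [abs_lt] at hp hm
  rw [abs_le]
  constructor <;> linarith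

theorem norm_le_of_forall_unit {g : StrongDual ℝ E} {c : ℝ} (hc : 0 ≤ c)
    (h : ∀ y : E, ‖y‖ = 1 → |g y| ≤ c) : ‖g‖ ≤ c := by
  refine g.opNorm_le_bound hc fun y => ?_
  by_cases hy : y = 0
  · simp [hy]
  have hy' : 0 < ‖y‖ := norm_pos_iff.2 hy
  have h1 := h (‖y‖⁻¹ • y) (by rw [norm_smul, norm_inv, norm_norm, inv_mul_cancel₀ hy'.ne'])
  rw [map_smul, smul_eq_mul, abs_mul, abs_inv, abs_norm, inv_mul_le_iff₀ hy'] at h1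
  rw [Real.norm_eq_abs]; linarith

/-- Quantitative continuity of supporting functionals on the unit sphere. -/
theorem exists_norm_sub_le (hs : IsUniformlySmooth E) {ε : ℝ} (hε : 0 < ε) :
    ∃ t : ℝ, 0 < t ∧ ∀ x x' : E, ‖x‖ = 1 → ‖x'‖ = 1 → ∀ g ∈ dualitySet x, ∀ g' ∈ dualitySet x',
      ‖g - g'‖ ≤ ε + 2 * ‖x - x'‖ / t := by
  obtain ⟨t, ht, h⟩ := exists_abs_sub_quotient_le hs (half_pos hε)
  refine ⟨t, ht, fun x x' hx hx' g hg g' hg' => norm_le_of_forall_unit (by positivity) ?_⟩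
  intro y hy
  have h1 := h x y hx hy g hg
  have h2 := h x' y hx' hy g' hg'
  have h3 : |(‖x + t • y‖ - ‖x‖) / t - (‖x' + t • y‖ - ‖x'‖) / t| ≤ 2 * ‖x - x'‖ / t := by
    rw [← sub_div, abs_div, abs_of_pos ht]
    gcongr
    rw [hx, hx']
    have := abs_norm_sub_norm_le (x + t • y) (x' + t • y)
    rw [add_sub_add_right_eq_sub] at this
    rw [sub_sub_sub_cancel_right]
    linarith [norm_nonneg (x - x')]
  rw [sub_apply]
  rw [abs_le] at *
  constructor <;> linarith [h1.1, h1.2, h2.1, h2.2, h3.1, h3.2]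

theorem eq_J_of_mem_dualitySet (hs : IsUniformlySmooth E) {x : E} {g : StrongDual ℝ E}
    (hg : g ∈ dualitySet x) : g = J x := by
  have unit : ∀ x : E, ‖x‖ = 1 → ∀ g ∈ dualitySet x, ∀ g' ∈ dualitySet x, g = g' := by
    intro x hx g hg g' hg'
    rw [← sub_eq_zero, ← norm_le_zero_iff]
    refine le_of_forall_pos_le_add fun ε hε => ?_
    obtain ⟨t, -, h⟩ := exists_norm_sub_le hs hε
    simpa using h x x hx hx g hg g' hg'
  by_cases hx : x = 0
  · have hg2 := hg.2
    rw [hx, norm_zero, zero_pow two_ne_zero, sq_eq_zero_iff, norm_eq_zero] at hg2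
    rw [hg2, eq_comm, ← norm_eq_zero, norm_J, hx, norm_zero]
  · have hx' : ‖x‖ ≠ 0 := norm_ne_zero_iff.2 hx
    have := unit (‖x‖⁻¹ • x) (by rw [norm_smul, norm_inv, norm_norm, inv_mul_cancel₀ hx'])
      _ (smul_mem_dualitySet hg _) _ (smul_mem_dualitySet (J_mem x) _)
    exact smul_right_injective _ (inv_ne_zero hx') this

theorem J_smul (hs : IsUniformlySmooth E) (t : ℝ) (x : E) : J (t • x) = t • J x :=
  (eq_J_of_mem_dualitySet hs (smul_mem_dualitySet (J_mem x) t)).symm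

/-- The duality mapping of a uniformly smooth space is norm-to-norm continuous. -/
theorem continuous_J (hs : IsUniformlySmooth E) : Continuous (J : E → StrongDual ℝ E) := by
  have sph : ContinuousOn (J : E → StrongDual ℝ E) (Metric.sphere 0 1) := by
    rw [Metric.continuousOn_iff]
    intro x hx ε hε
    obtain ⟨t, ht, h⟩ := exists_norm_sub_le hs (half_pos hε)
    refine ⟨ε * t / 4, by positivity, fun x' hx' hd => ?_⟩
    rw [dist_eq_norm] at hd ⊢
    have h1 := h x' x (by simpa using hx') (by simpa using hx) _ (J_mem x') _ (J_mem x)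
    have h2 : 2 * ‖x' - x‖ / t < ε / 2 := by
      rw [div_lt_iff₀ ht]; linarith
    linarith
  have hJ : (J : E → StrongDual ℝ E) = fun x => ‖x‖ • J (‖x‖⁻¹ • x) := by
    funext x
    rw [← J_smul hs]
    by_cases hx : x = 0
    · simp [hx]
    · rw [smul_inv_smul₀ (norm_ne_zero_iff.2 hx)]
  rw [continuous_iff_continuousAt]
  intro p
  by_cases hp : p = 0
  · have h0 : J p = 0 := by rw [← norm_eq_zero, norm_J, hp, norm_zero]
    rw [ContinuousAt, h0, tendsto_zero_iff_norm_tendsto_zero]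
    simp only [norm_J]
    have := (continuous_norm (E := E)).tendsto p
    rwa [hp, norm_zero] at *
  · have hn : ContinuousOn (fun x : E => ‖x‖⁻¹ • x) {0}ᶜ :=
      (continuous_norm.continuousOn.inv₀ fun x hx => norm_ne_zero_iff.2 hx).smul continuousOn_id
    have hc : ContinuousOn (fun x : E => ‖x‖ • J (‖x‖⁻¹ • x)) {0}ᶜ := by
      refine continuous_norm.continuousOn.smul (sph.comp hn fun x hx => ?_)
      rw [mem_sphere_zero_iff_norm, norm_smul, norm_inv, norm_norm,
        inv_mul_cancel₀ (norm_ne_zero_iff.2 hx)]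
    rw [hJ]
    exact hc.continuousAt (isOpen_compl_singleton.mem_nhds hp)

theorem tendsto_clm_apply {ι : Type*} {l : Filter ι} {g : ι → StrongDual ℝ E} {x : ι → E}
    {g₀ : StrongDual ℝ E} {p : E} (hg : Tendsto g l (𝓝 g₀)) (hx : Tendsto x l (𝓝 p)) :
    Tendsto (fun n => g n (x n)) l (𝓝 (g₀ p)) :=
  (isBoundedBilinearMap_apply.continuous.tendsto (g₀, p)).comp (hg.prodMk_nhds hx)

theorem tendsto_phi (hs : IsUniformlySmooth E) {ι : Type*} {l : Filter ι} {x y : ι → E} {p q : E}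
    (hx : Tendsto x l (𝓝 p)) (hy : Tendsto y l (𝓝 q)) :
    Tendsto (fun n => phi (x n) (y n)) l (𝓝 (phi p q)) := by
  have hJ : Tendsto (fun n => J (y n) (x n)) l (𝓝 (J q p)) := by
    have h : Tendsto (fun n => J (y n)) l (𝓝 (J q)) := ((continuous_J hs).tendsto q).comp hy
    exact tendsto_clm_apply h hx
  exact ((hx.norm.pow 2).sub (hJ.const_mul 2)).add (hy.norm.pow 2)

end Geometry

section Completeness

variable {E : Type*} [NormedAddCommGroup E] [NormedSpace ℝ E]

/-! ### Minimization over closed convex sets -/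

/-- The functional `‖·‖² - 2 g` is strongly midpoint convex. -/
theorem exists_strong_midpoint_convexity (hconv : IsTwoUniformlyConvex E) :
    ∃ ν : ℝ, 0 < ν ∧ ∀ (g : StrongDual ℝ E) (x y : E),
      ν * ‖x - y‖ ^ 2 + (‖(2 : ℝ)⁻¹ • (x + y)‖ ^ 2 - 2 * g ((2 : ℝ)⁻¹ • (x + y))) ≤
        ((‖x‖ ^ 2 - 2 * g x) + (‖y‖ ^ 2 - 2 * g y)) / 2 := by
  obtain ⟨μ, hμ, hφ⟩ := exists_mul_sq_le_phi hconv
  refine ⟨μ / 4, by positivity, fun g x y => ?_⟩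
  obtain ⟨m, hm⟩ : ∃ m, m = (2 : ℝ)⁻¹ • (x + y) := ⟨_, rfl⟩
  have hxy : x + y = (2 : ℝ) • m := by rw [hm, smul_inv_smul₀ two_ne_zero]
  have e1 : x - m = (2 : ℝ)⁻¹ • (x - y) := by rw [hm]; module
  have e2 : y - m = -((2 : ℝ)⁻¹ • (x - y)) := by rw [hm]; module
  have n1 : ‖(2 : ℝ)⁻¹ • (x - y)‖ = ‖x - y‖ / 2 := by
    rw [norm_smul, norm_inv, Real.norm_two]; ring
  have h1 := hφ x m
  have h2 := hφ y m
  rw [e1, n1] at h1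
  rw [e2, norm_neg, n1] at h2
  have h3 : J m x + J m y = 2 * ‖m‖ ^ 2 := by
    rw [← map_add, hxy, map_smul, J_apply_self, smul_eq_mul]
  have h4 : g x + g y = 2 * g m := by
    rw [← map_add, hxy, map_smul, smul_eq_mul]
  rw [← hm]
  simp only [phi] at h1 h2
  nlinarith

/-- Quadratic growth of `‖·‖² - 2 g` away from its minimizer over a convex set. -/
theorem exists_quadratic_growth (hconv : IsTwoUniformlyConvex E) :
    ∃ ν : ℝ, 0 < ν ∧ ∀ (g : StrongDual ℝ E) (D : Set E), Convex ℝ D → ∀ y ∈ D,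
      (∀ q ∈ D, ‖y‖ ^ 2 - 2 * g y ≤ ‖q‖ ^ 2 - 2 * g q) → ∀ q ∈ D,
        ν * ‖q - y‖ ^ 2 ≤ (‖q‖ ^ 2 - 2 * g q) - (‖y‖ ^ 2 - 2 * g y) := by
  obtain ⟨ν, hν, h⟩ := exists_strong_midpoint_convexity hconv
  refine ⟨2 * ν, by positivity, fun g D hD y hy hmin q hq => ?_⟩
  have hm : (2 : ℝ)⁻¹ • (q + y) ∈ D := by
    rw [smul_add]
    exact hD hq hy (by norm_num) (by norm_num) (by norm_num)
  have h1 := h g q y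
  have h2 := hmin _ hm
  linarith

omit [NormedSpace ℝ E] in
theorem exists_tendsto_of_sq_le [CompleteSpace E] {β : Type*} [Nonempty β] [SemilatticeSup β]
    {x : β → E} {a : β → ℝ} {ν : ℝ} (hν : 0 < ν) (ha : BddAbove (range a))
    (h : ∀ s t, s ≤ t → ν * ‖x t - x s‖ ^ 2 ≤ a t - a s) : ∃ p, Tendsto x atTop (𝓝 p) := by
  refine cauchySeq_tendsto_of_complete (Metric.cauchySeq_iff'.2 fun ε hε => ?_)
  obtain ⟨_, ⟨s, rfl⟩, hs⟩ := exists_lt_of_lt_csSup (range_nonempty a)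
    (sub_lt_self (sSup (range a)) (by positivity : 0 < ν * ε ^ 2))
  refine ⟨s, fun t hst => ?_⟩
  have h1 := h s t hst
  have h2 : a t ≤ sSup (range a) := le_csSup ha (mem_range_self t)
  rw [dist_eq_norm]
  refine lt_of_pow_lt_pow_left₀ 2 hε.le (lt_of_mul_lt_mul_left ?_ hν.le)
  linarith

theorem exists_minimizer [CompleteSpace E] (hconv : IsTwoUniformlyConvex E) (g : StrongDual ℝ E)
    {D : Set E} (hne : D.Nonempty) (hcl : IsClosed D) (hcv : Convex ℝ D) :
    ∃ y ∈ D, ∀ q ∈ D, ‖y‖ ^ 2 - 2 * g y ≤ ‖q‖ ^ 2 - 2 * g q := by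
  obtain ⟨ν, hν, h⟩ := exists_strong_midpoint_convexity hconv
  set F : E → ℝ := fun q => ‖q‖ ^ 2 - 2 * g q with hF
  have hFc : Continuous F := by fun_prop
  have hbdd : BddBelow (F '' D) := by
    refine ⟨-‖g‖ ^ 2, ?_⟩
    rintro _ ⟨q, -, rfl⟩
    have h1 := (le_abs_self _).trans (g.le_opNorm q)
    simp only [hF]
    nlinarith [sq_nonneg (‖g‖ - ‖q‖)]
  set I := sInf (F '' D)
  have hI : ∀ q ∈ D, I ≤ F q := fun q hq => csInf_le hbdd (mem_image_of_mem F hq)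
  have hex : ∀ n : ℕ, ∃ q ∈ D, F q < I + 1 / ((n : ℝ) + 1) := by
    intro n
    obtain ⟨_, ⟨q, hq, rfl⟩, hlt⟩ := exists_lt_of_csInf_lt (hne.image F)
      (lt_add_of_pos_right I (by positivity : (0 : ℝ) < 1 / ((n : ℝ) + 1)))
    exact ⟨q, hq, hlt⟩
  choose q hqD hq using hex
  have hz : Tendsto (fun n : ℕ => 1 / ((n : ℝ) + 1)) atTop (𝓝 0) :=
    tendsto_one_div_add_atTop_nhds_zero_nat
  have hcauchy : CauchySeq q := by
    refine cauchySeq_of_le_tendsto_0' (fun n : ℕ => √(ν⁻¹ * (1 / ((n : ℝ) + 1))))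
      (fun n m hnm => ?_) ?_
    · rw [dist_eq_norm]
      refine Real.le_sqrt_of_sq_le ?_
      rw [← div_eq_inv_mul, le_div_iff₀ hν]
      have hm : (2 : ℝ)⁻¹ • (q n + q m) ∈ D := by
        rw [smul_add]
        exact hcv (hqD n) (hqD m) (by norm_num) (by norm_num) (by norm_num)
      have h1 : ν * ‖q n - q m‖ ^ 2 + F ((2 : ℝ)⁻¹ • (q n + q m)) ≤ (F (q n) + F (q m)) / 2 :=
        h g (q n) (q m)
      have h2 := hI _ hm
      have h3 : 1 / ((m : ℝ) + 1) ≤ 1 / ((n : ℝ) + 1) := by gcongr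
      have h4 := hq n
      have h5 := hq m
      linarith
    · simpa using (hz.const_mul ν⁻¹).sqrt
  obtain ⟨p, hp⟩ := cauchySeq_tendsto_of_complete hcauchy
  refine ⟨p, hcl.mem_of_tendsto hp (Eventually.of_forall hqD), fun v hv => ?_⟩
  have h1 : Tendsto (fun n => F (q n)) atTop (𝓝 (F p)) := (hFc.tendsto p).comp hp
  have h2 : Tendsto (fun n : ℕ => I + 1 / ((n : ℝ) + 1)) atTop (𝓝 (I + 0)) := hz.const_add I
  have h3 := le_of_tendsto_of_tendsto' h1 h2 fun n => (hq n).le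
  rw [add_zero] at h3
  exact h3.trans (hI v hv)

/-- A substitute for weak compactness: a family of closed convex sets all of whose finite
subfamilies have common points in a fixed ball has a common point. The elements of least norm of the
finite intersections form a convergent net. -/
theorem exists_forall_mem_of_finite_inter [CompleteSpace E] (hconv : IsTwoUniformlyConvex E)
    {ι : Type*} {K : ι → Set E} (hcl : ∀ i, IsClosed (K i)) (hcv : ∀ i, Convex ℝ (K i)) {R : ℝ}
    (hfin : ∀ s : Finset ι, ∃ z, ‖z‖ ≤ R ∧ ∀ i ∈ s, z ∈ K i) : ∃ z, ∀ i, z ∈ K i := by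
  classical
  obtain ⟨ν, hν, hgrow⟩ := exists_quadratic_growth hconv
  have hmemI : ∀ (s : Finset ι) (z : E), z ∈ (⋂ i ∈ s, K i) ↔ ∀ i ∈ s, z ∈ K i :=
    fun s z => mem_iInter₂
  have hcvI : ∀ s : Finset ι, Convex ℝ (⋂ i ∈ s, K i) :=
    fun s => convex_iInter₂ fun i _ => hcv i
  have hmin : ∀ s : Finset ι, ∃ y ∈ (⋂ i ∈ s, K i), ∀ q ∈ (⋂ i ∈ s, K i),
      ‖y‖ ^ 2 - 2 * (0 : StrongDual ℝ E) y ≤ ‖q‖ ^ 2 - 2 * (0 : StrongDual ℝ E) q := by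
    intro s
    obtain ⟨z, -, hz⟩ := hfin s
    exact exists_minimizer hconv 0 ⟨z, (hmemI s z).2 hz⟩ (isClosed_biInter fun i _ => hcl i)
      (hcvI s)
  choose y hyK hy using hmin
  have hsub : ∀ s t : Finset ι, s ≤ t → y t ∈ ⋂ i ∈ s, K i := fun s t hst =>
    (hmemI s _).2 fun i hi => (hmemI t _).1 (hyK t) i (hst hi)
  obtain ⟨p, hp⟩ : ∃ p, Tendsto y atTop (𝓝 p) := by
    refine exists_tendsto_of_sq_le (a := fun s => ‖y s‖ ^ 2) hν ⟨R ^ 2, ?_⟩ fun s t hst => ?_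
    · rintro _ ⟨s, rfl⟩
      obtain ⟨z, hzR, hz⟩ := hfin s
      have := hy s z ((hmemI s z).2 hz)
      simp only [zero_apply, mul_zero, sub_zero] at this
      exact this.trans (by gcongr)
    · simpa using hgrow 0 _ (hcvI s) (y s) (hyK s) (hy s) (y t) (hsub s t hst)
  refine ⟨p, fun i => (hcl i).mem_of_tendsto hp ?_⟩
  filter_upwards [eventually_ge_atTop {i}] with s hs
  exact (hmemI s _).1 (hyK s) i (hs (Finset.mem_singleton_self i))

/-- In a uniformly smooth and 2-uniformly convex Banach space the duality mapping is onto: a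
minimizer of `‖·‖² - 2 g` over the whole space is sent to `g`. -/
theorem J_surjective [CompleteSpace E] (hs : IsUniformlySmooth E) (hconv : IsTwoUniformlyConvex E) :
    Function.Surjective (J : E → StrongDual ℝ E) := by
  intro g
  obtain ⟨v, -, hv⟩ := exists_minimizer hconv g univ_nonempty isClosed_univ convex_univ
  have hmin : ∀ (t : ℝ) (y : E), 2 * t * g y ≤ ‖v + t • y‖ ^ 2 - ‖v‖ ^ 2 := fun t y => by
    have := hv (v + t • y) (mem_univ _)
    rw [map_add, map_smul, smul_eq_mul] at this
    linarith
  have hself : g v = ‖v‖ ^ 2 := by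
    have h1 : ∀ t : ℝ, 2 * t * g v ≤ (2 * t + t ^ 2) * ‖v‖ ^ 2 := fun t => by
      have := hmin t v
      have e : v + t • v = (1 + t) • v := by module
      rw [e, norm_smul, mul_pow, Real.norm_eq_abs, sq_abs] at this
      linarith
    refine le_antisymm (le_of_forall_pos_le_add fun ε hε => ?_)
      (le_of_forall_pos_le_add fun ε hε => ?_)
    · have ht : 0 < ε / (‖v‖ ^ 2 + 1) := by positivity
      have h2 := h1 (ε / (‖v‖ ^ 2 + 1))
      have h3 : ε / (‖v‖ ^ 2 + 1) * ‖v‖ ^ 2 ≤ ε := by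
        rw [div_mul_eq_mul_div, div_le_iff₀ (by positivity)]; nlinarith
      set t := ε / (‖v‖ ^ 2 + 1)
      have h4 : t * (2 * g v) ≤ t * (2 * ‖v‖ ^ 2 + t * ‖v‖ ^ 2) := by linarith
      have h5 := le_of_mul_le_mul_left h4 ht
      linarith
    · have ht : 0 < ε / (‖v‖ ^ 2 + 1) := by positivity
      have h2 := h1 (-(ε / (‖v‖ ^ 2 + 1)))
      have h3 : ε / (‖v‖ ^ 2 + 1) * ‖v‖ ^ 2 ≤ ε := by
        rw [div_mul_eq_mul_div, div_le_iff₀ (by positivity)]; nlinarith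
      set t := ε / (‖v‖ ^ 2 + 1)
      have h4 : t * (2 * ‖v‖ ^ 2) ≤ t * (2 * g v + t * ‖v‖ ^ 2) := by linarith
      have h5 := le_of_mul_le_mul_left h4 ht
      linarith
  have hnorm : ‖g‖ ≤ ‖v‖ := by
    have half : ∀ y : E, ‖y‖ = 1 → g y ≤ ‖v‖ := by
      intro y hy
      refine le_of_forall_pos_le_add fun ε hε => ?_
      have h1 := hmin ε y
      have h2 : ‖v + ε • y‖ ≤ ‖v‖ + ε := by
        refine (norm_add_le _ _).trans ?_
        rw [norm_smul, hy, mul_one, Real.norm_of_nonneg hε.le]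
      have h3 : ‖v + ε • y‖ ^ 2 ≤ (‖v‖ + ε) ^ 2 := by gcongr
      have h4 : ε * (2 * g y) ≤ ε * (2 * ‖v‖ + ε) := by linarith
      linarith [le_of_mul_le_mul_left h4 hε]
    refine norm_le_of_forall_unit (norm_nonneg _) fun y hy => abs_le.2 ⟨?_, half y hy⟩
    have := half (-y) (by rwa [norm_neg])
    rw [map_neg] at this
    linarith
  have hnorm' : ‖v‖ ≤ ‖g‖ := by
    rcases (norm_nonneg v).eq_or_lt with h0 | h0
    · rw [← h0]; exact norm_nonneg _
    · have := (le_abs_self _).trans (g.le_opNorm v)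
      rw [hself, sq] at this
      exact le_of_mul_le_mul_right this h0
  refine ⟨v, (eq_J_of_mem_dualitySet hs ⟨hself, ?_⟩).symm⟩
  rw [le_antisymm hnorm hnorm']

/-! ### Generalized projections -/

theorem exists_isGenProj [CompleteSpace E] (hconv : IsTwoUniformlyConvex E) {D : Set E}
    (hne : D.Nonempty) (hcl : IsClosed D) (hcv : Convex ℝ D) (x : E) : ∃ p, IsGenProj D x p := by
  obtain ⟨p, hp, h⟩ := exists_minimizer hconv (J x) hne hcl hcv
  exact ⟨p, hp, fun q hq => by have := h q hq; simp only [phi]; linarith⟩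

theorem exists_quadratic_growth_phi (hconv : IsTwoUniformlyConvex E) :
    ∃ ν : ℝ, 0 < ν ∧ ∀ (D : Set E) (x p : E), Convex ℝ D → IsGenProj D x p → ∀ q ∈ D,
        ν * ‖q - p‖ ^ 2 ≤ phi q x - phi p x := by
  obtain ⟨ν, hν, h⟩ := exists_quadratic_growth hconv
  refine ⟨ν, hν, fun D x p hD hp q hq => ?_⟩
  have := h (J x) D hD p hp.1
    (fun v hv => by have := hp.2 v hv; simp only [phi] at this; linarith) q hq
  simp only [phi]
  linarith

theorem IsGenProj.variational (hs : IsUniformlySmooth E) {D : Set E} (hD : Convex ℝ D) {x p : E}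
    (hp : IsGenProj D x p) {q : E} (hq : q ∈ D) : 0 ≤ (J p - J x) (q - p) := by
  have hc : Tendsto (fun t : ℝ => (J (p + t • (q - p)) - J x) (q - p)) (𝓝[>] 0)
      (𝓝 ((J p - J x) (q - p))) := by
    have h1 : Continuous fun t : ℝ => J (p + t • (q - p)) :=
      (continuous_J hs).comp (by fun_prop)
    have h2 := (h1.tendsto 0).mono_left (nhdsWithin_le_nhds (s := Ioi 0))
    rw [zero_smul, add_zero] at h2
    exact tendsto_clm_apply (h2.sub_const _) tendsto_const_nhds
  refine ge_of_tendsto hc ?_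
  filter_upwards [Ioo_mem_nhdsGT (zero_lt_one (α := ℝ))] with t ht
  have hm : p + t • (q - p) ∈ D := hD.add_smul_sub_mem hp.1 hq ⟨ht.1.le, ht.2.le⟩
  have h1 := hp.2 _ hm
  -- convexity of `‖·‖²` at the perturbed point
  have h2 := phi_nonneg p (p + t • (q - p))
  have e : J (p + t • (q - p)) p =
      ‖p + t • (q - p)‖ ^ 2 - t * J (p + t • (q - p)) (q - p) := by
    rw [← J_apply_self (p + t • (q - p)), map_add, map_smul, smul_eq_mul]; ring
  simp only [phi] at h1 h2
  rw [e] at h2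
  rw [map_add, map_smul, smul_eq_mul] at h1
  rw [sub_apply]
  have h3 : t * 0 ≤ t * (J (p + t • (q - p)) (q - p) - J x (q - p)) := by linarith
  exact le_of_mul_le_mul_left h3 ht.1

theorem IsGenProj.phi_add_phi_le (hs : IsUniformlySmooth E) {D : Set E} (hD : Convex ℝ D)
    {x p : E} (hp : IsGenProj D x p) {q : E} (hq : q ∈ D) : phi q p + phi p x ≤ phi q x := by
  linarith [phi_three_point q p x, hp.variational hs hD hq]

end Completeness

section Equilibrium

variable {E : Type*} [NormedAddCommGroup E] [NormedSpace ℝ E]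

/-! ### Equilibrium problems -/

omit [NormedSpace ℝ E] in
theorem le_of_lowerSemicontinuousOn {C : Set E} {g : E → ℝ} (hg : LowerSemicontinuousOn g C)
    {x : ℕ → E} {p : E} (hx : ∀ n, x n ∈ C) (hp : p ∈ C) (hlim : Tendsto x atTop (𝓝 p))
    {c : ℕ → ℝ} {c₀ : ℝ} (hc : Tendsto c atTop (𝓝 c₀)) (h : ∀ n, g (x n) ≤ c n) : g p ≤ c₀ := by
  refine le_of_forall_lt fun y hy => ?_
  obtain ⟨y', hy1, hy2⟩ := exists_between hy
  have h1 : ∀ᶠ n in atTop, y' < g (x n) :=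
    (tendsto_nhdsWithin_iff.2 ⟨hlim, Eventually.of_forall hx⟩).eventually (hg p hp y' hy2)
  exact hy1.trans_le (ge_of_tendsto hc (h1.mono fun n hn => hn.le.trans (h n)))

omit [NormedSpace ℝ E] in
theorem isClosed_setOf_le_of_lowerSemicontinuousOn {C : Set E} (hC : IsClosed C) {g : E → ℝ}
    (hg : LowerSemicontinuousOn g C) (c : ℝ) : IsClosed {z | z ∈ C ∧ g z ≤ c} := by
  refine IsSeqClosed.isClosed fun x p hx hp => ?_
  have hpC : p ∈ C := hC.mem_of_tendsto hp (Eventually.of_forall fun n => (hx n).1)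
  exact ⟨hpC, le_of_lowerSemicontinuousOn hg (fun n => (hx n).1) hpC hp tendsto_const_nhds
    fun n => (hx n).2⟩

/-- Minty's lemma for bifunctions. -/
theorem mem_EP_of_forall_le {C : Set E} (hC : Convex ℝ C) {f : E → E → ℝ} (hf : CondA f C)
    {z : E} (hz : z ∈ C) (h : ∀ y ∈ C, f y z ≤ 0) : z ∈ EP f C := by
  refine ⟨hz, fun y hy => ?_⟩
  have hev : ∀ᶠ t : ℝ in 𝓝[>] 0, (0 : EReal) ≤ ((f (t • y + (1 - t) • z) y : ℝ) : EReal) := by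
    filter_upwards [Ioo_mem_nhdsGT (zero_lt_one (α := ℝ))] with t ht
    have hm : t • y + (1 - t) • z ∈ C :=
      hC hy hz ht.1.le (sub_nonneg.2 ht.2.le) (by ring)
    have h1 := (hf.convex _ hm).2 hy hz ht.1.le (sub_nonneg.2 ht.2.le) (by ring)
    rw [hf.diag _ hm, smul_eq_mul, smul_eq_mul] at h1
    have h2 : (1 - t) * f (t • y + (1 - t) • z) z ≤ 0 :=
      mul_nonpos_of_nonneg_of_nonpos (sub_nonneg.2 ht.2.le) (h _ hm)
    have h3 : t * 0 ≤ t * f (t • y + (1 - t) • z) y := by linarith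
    exact_mod_cast le_of_mul_le_mul_left h3 ht.1
  have h0 : (0 : EReal) ≤ limsup (fun t : ℝ => ((f (t • y + (1 - t) • z) y : ℝ) : EReal))
      (𝓝[>] 0) :=
    (limsup_const (f := 𝓝[>] (0 : ℝ)) (0 : EReal)).ge.trans (limsup_le_limsup hev)
  exact_mod_cast h0.trans (hf.limsup_le z hz y hy y hy)

/-- A theorem of the alternative: if finitely many convex functions are nowhere simultaneously
negative, then some convex combination of them is nonnegative. -/
theorem exists_weights_of_forall_exists_nonneg {V : Type*} [AddCommGroup V] [Module ℝ V]
    {Z : Set V} (hZ : Z.Nonempty) {ι : Type*} [Fintype ι] {h : ι → V → ℝ}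
    (hh : ∀ i, ConvexOn ℝ Z (h i)) (hno : ∀ z ∈ Z, ∃ i, 0 ≤ h i z) :
    ∃ m : ι → ℝ, (∀ i, 0 ≤ m i) ∧ ∑ i, m i = 1 ∧ ∀ z ∈ Z, 0 ≤ ∑ i, m i * h i z := by
  classical
  -- separate the origin from the open convex set of strict majorants of the values
  set P : Set (ι → ℝ) := ⋃ z ∈ Z, {v | ∀ i, h i z < v i} with hP
  have hmemP : ∀ v, v ∈ P ↔ ∃ z ∈ Z, ∀ i, h i z < v i := fun v => by simp [hP]
  have hopen : IsOpen P := by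
    refine isOpen_biUnion fun z _ => ?_
    have : {v : ι → ℝ | ∀ i, h i z < v i} = ⋂ i, {v | h i z < v i} := by ext; simp
    rw [this]
    exact isOpen_iInter_of_finite fun i => isOpen_lt continuous_const (continuous_apply i)
  have hconvex : Convex ℝ P := by
    intro v hv v' hv' a b ha hb hab
    rw [hmemP] at *
    obtain ⟨z, hz, hzv⟩ := hv
    obtain ⟨z', hz', hzv'⟩ := hv'
    obtain ⟨i₀, -⟩ := hno z hz
    refine ⟨a • z + b • z', (hh i₀).1 hz hz' ha hb hab, fun i => ?_⟩
    refine ((hh i).2 hz hz' ha hb hab).trans_lt ?_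
    simp only [smul_eq_mul, Pi.add_apply, Pi.smul_apply]
    rcases ha.eq_or_lt with h0 | h0
    · have : b = 1 := by linarith
      subst this; rw [← h0]; linarith [hzv' i]
    · have h1 := mul_lt_mul_of_pos_left (hzv i) h0
      have h2 := mul_le_mul_of_nonneg_left (hzv' i).le hb
      linarith
  have h0 : (0 : ι → ℝ) ∉ P := by
    rw [hmemP]
    rintro ⟨z, hz, hlt⟩
    obtain ⟨i, hi⟩ := hno z hz
    exact absurd (hlt i) (not_lt.2 hi)
  obtain ⟨φ, hφ⟩ := geometric_hahn_banach_open_point hconvex hopen h0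
  rw [map_zero] at hφ
  set e : ι → ℝ := fun i => φ (Pi.single i 1) with he
  have hφe : ∀ v, φ v = ∑ i, v i * e i := by
    intro v
    conv_lhs => rw [pi_eq_sum_univ' v, map_sum]
    refine Finset.sum_congr rfl fun i _ => ?_
    rw [map_smul, smul_eq_mul, he]
  obtain ⟨z₀, hz₀⟩ := hZ
  have hbase : (fun i => h i z₀ + 1) ∈ P := (hmemP _).2 ⟨z₀, hz₀, fun i => lt_add_one _⟩
  have hneg : ∀ i, e i ≤ 0 := by
    intro i
    by_contra hi
    rw [not_le] at hi
    set v : ι → ℝ := fun i => h i z₀ + 1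
    have hv0 : φ v < 0 := hφ v hbase
    set t := -φ v / e i
    have ht : 0 < t := div_pos (neg_pos.2 hv0) hi
    have hmem : v + t • Pi.single i 1 ∈ P := by
      refine (hmemP _).2 ⟨z₀, hz₀, fun j => ?_⟩
      have : 0 ≤ t * (Pi.single i 1 : ι → ℝ) j := by
        refine mul_nonneg ht.le ?_
        by_cases hj : j = i
        · subst hj; simp
        · simp [hj]
      simp only [Pi.add_apply, Pi.smul_apply, smul_eq_mul, v]
      linarith
    have h1 := hφ _ hmem
    rw [map_add, map_smul, smul_eq_mul] at h1
    have h2 : t * e i = -φ v := div_mul_cancel₀ _ hi.ne'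
    simp only [he] at h2
    linarith
  have hsum : ∑ i, e i < 0 := by
    refine lt_of_le_of_ne (Finset.sum_nonpos fun i _ => hneg i) fun h0 => ?_
    have hall : ∀ i, e i = 0 := fun i =>
      (Finset.sum_eq_zero_iff_of_nonpos fun i _ => hneg i).1 h0 i (Finset.mem_univ i)
    have := hφ _ hbase
    rw [hφe] at this
    simp [hall] at this
  refine ⟨fun i => e i / ∑ i, e i, fun i => div_nonneg_of_nonpos (hneg i) hsum.le, ?_, ?_⟩
  · rw [← Finset.sum_div, div_self hsum.ne]
  · intro z hz
    have key : ∑ i, h i z * e i ≤ 0 := by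
      have hlim : Tendsto (fun ε : ℝ => ∑ i, (h i z + ε) * e i) (𝓝[>] 0)
          (𝓝 (∑ i, (h i z + 0) * e i)) := by
        have : Continuous fun ε : ℝ => ∑ i, (h i z + ε) * e i := by fun_prop
        exact (this.tendsto 0).mono_left nhdsWithin_le_nhds
      simp only [add_zero] at hlim
      refine le_of_tendsto hlim ?_
      filter_upwards [self_mem_nhdsWithin] with ε hε
      rw [← hφe]
      exact (hφ _ ((hmemP _).2 ⟨z, hz, fun i => lt_add_of_pos_right _ hε⟩)).le
    have e1 : ∑ i, e i / (∑ i, e i) * h i z = (∑ i, h i z * e i) / ∑ i, e i := by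
      rw [Finset.sum_div]
      exact Finset.sum_congr rfl fun i _ => by ring
    rw [e1]
    exact div_nonneg_of_nonpos key hsum.le

theorem exists_linear_minorant {C : Set E} {g : E → ℝ} (hcv : ConvexOn ℝ C g)
    (hlsc : LowerSemicontinuousOn g C) {y₀ : E} (hy₀ : y₀ ∈ C) (h0 : g y₀ = 0) :
    ∃ B : ℝ, 0 ≤ B ∧ ∀ z ∈ C, -(1 + B * ‖z - y₀‖) ≤ g z := by
  have h1 := hlsc y₀ hy₀ (-1) (by change -1 < g y₀; rw [h0]; norm_num)
  rw [eventually_nhdsWithin_iff, Metric.eventually_nhds_iff] at h1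
  obtain ⟨δ, hδ, h⟩ := h1
  refine ⟨2 / δ, by positivity, fun z hz => ?_⟩
  by_cases hd : ‖z - y₀‖ < δ
  · have := h (by rwa [dist_eq_norm]) hz
    have h2 : 0 ≤ 2 / δ * ‖z - y₀‖ := by positivity
    linarith
  · rw [not_lt] at hd
    have hpos : 0 < ‖z - y₀‖ := hδ.trans_le hd
    set t := δ / 2 / ‖z - y₀‖ with ht
    have ht0 : 0 < t := by positivity
    have ht1 : t ≤ 1 := by rw [ht, div_le_one hpos]; linarith
    have hm : t • z + (1 - t) • y₀ ∈ C := hcv.1 hz hy₀ ht0.le (sub_nonneg.2 ht1) (by ring)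
    have h2 := hcv.2 hz hy₀ ht0.le (sub_nonneg.2 ht1) (by ring)
    have e : t • z + (1 - t) • y₀ - y₀ = t • (z - y₀) := by module
    have h3 : -1 < g (t • z + (1 - t) • y₀) := by
      refine h ?_ hm
      rw [dist_eq_norm, e, norm_smul, Real.norm_of_nonneg ht0.le, ht, div_mul_cancel₀ _ hpos.ne']
      linarith
    rw [h0, smul_eq_mul, smul_zero, add_zero] at h2
    have h4 : t * (2 / δ * ‖z - y₀‖) = 1 := by rw [ht]; field_simp
    have h5 : t * (-(2 / δ * ‖z - y₀‖)) ≤ t * g z := by linarith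
    linarith [le_of_mul_le_mul_left h5 ht0]

/-- A strongly monotone equilibrium problem has approximate solutions of Minty type for every finite
set of test points. -/
theorem exists_approx_minty {C : Set E} (hCne : C.Nonempty) (hC : Convex ℝ C) {h : E → E → ℝ}
    (hcv : ∀ x ∈ C, ConvexOn ℝ C (h x)) {ν : ℝ} (hν : 0 < ν)
    (hmon : ∀ x ∈ C, ∀ y ∈ C, h x y + h y x ≤ -(2 * ν * ‖x - y‖ ^ 2))
    {ι : Type*} [Fintype ι] (y : ι → E) (hy : ∀ i, y i ∈ C) {ε : ℝ} (hε : 0 < ε) :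
    ∃ z ∈ C, ∀ i, h (y i) z + ν * ‖z - y i‖ ^ 2 < ε := by
  by_contra hno
  push Not at hno
  have hnorm : ∀ c : E, ConvexOn ℝ C fun z => ‖z - c‖ ^ 2 := fun c => by
    have h1 : ConvexOn ℝ C fun z => ‖z - c‖ := by
      refine ⟨hC, fun a _ b _ s t hs ht hst => ?_⟩
      have e : s • a + t • b - c = s • (a - c) + t • (b - c) := by
        have : c = (s + t) • c := by rw [hst, one_smul]
        conv_lhs => rw [this]
        module
      change ‖s • a + t • b - c‖ ≤ s • ‖a - c‖ + t • ‖b - c‖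
      rw [e]
      refine (norm_add_le _ _).trans ?_
      rw [norm_smul, norm_smul, Real.norm_of_nonneg hs, Real.norm_of_nonneg ht, smul_eq_mul,
        smul_eq_mul]
    exact h1.pow (fun _ _ => norm_nonneg _) 2
  have hK : ∀ i, ConvexOn ℝ C fun z => h (y i) z + ν * ‖z - y i‖ ^ 2 := fun i =>
    (hcv _ (hy i)).add ((hnorm (y i)).smul hν.le)
  obtain ⟨m, hm0, hm1, hm⟩ := exists_weights_of_forall_exists_nonneg hCne
    (h := fun i z => h (y i) z + ν * ‖z - y i‖ ^ 2 + -ε)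
    (fun i => (hK i).add (convexOn_const _ hC)) (fun z hz => by
      obtain ⟨i, hi⟩ := hno z hz
      exact ⟨i, by linarith⟩)
  -- test the convex combination of the points themselves with the same weights
  have hzC : ∑ i, m i • y i ∈ C := hC.sum_mem (fun i _ => hm0 i) hm1 fun i _ => hy i
  have h1 := hm _ hzC
  have h2 : ∀ j, h (y j) (∑ i, m i • y i) + ν * ‖∑ i, m i • y i - y j‖ ^ 2 ≤
      ∑ i, m i * (h (y j) (y i) + ν * ‖y i - y j‖ ^ 2) := fun j => by
    simpa only [smul_eq_mul] using
      (hK j).map_sum_le (t := Finset.univ) (fun i _ => hm0 i) hm1 fun i _ => hy i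
  have h3 : ∑ j, m j * (h (y j) (∑ i, m i • y i) + ν * ‖∑ i, m i • y i - y j‖ ^ 2 + -ε) ≤
      ∑ j, m j * (∑ i, m i * (h (y j) (y i) + ν * ‖y i - y j‖ ^ 2) + -ε) := by
    refine Finset.sum_le_sum fun j _ => mul_le_mul_of_nonneg_left ?_ (hm0 j)
    linarith [h2 j]
  set T := ∑ j, ∑ i, m j * m i * (h (y j) (y i) + ν * ‖y i - y j‖ ^ 2) with hT
  have h4 : ∑ j, m j * (∑ i, m i * (h (y j) (y i) + ν * ‖y i - y j‖ ^ 2) + -ε) = T - ε := by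
    have : ∀ j, m j * (∑ i, m i * (h (y j) (y i) + ν * ‖y i - y j‖ ^ 2) + -ε) =
        ∑ i, m j * m i * (h (y j) (y i) + ν * ‖y i - y j‖ ^ 2) - m j * ε := fun j => by
      rw [mul_add, Finset.mul_sum, mul_neg, ← sub_eq_add_neg]
      congr 1
      exact Finset.sum_congr rfl fun i _ => by ring
    simp only [this]
    rw [Finset.sum_sub_distrib, ← Finset.sum_mul, hm1, one_mul]
  have h5 : T = ∑ j, ∑ i, m j * m i * (h (y i) (y j) + ν * ‖y i - y j‖ ^ 2) := by
    rw [hT, Finset.sum_comm]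
    refine Finset.sum_congr rfl fun j _ => Finset.sum_congr rfl fun i _ => ?_
    rw [norm_sub_rev (y j) (y i)]; ring
  have h6 : T + T ≤ 0 := by
    nth_rewrite 2 [h5]
    rw [hT, ← Finset.sum_add_distrib]
    refine Finset.sum_nonpos fun j _ => ?_
    rw [← Finset.sum_add_distrib]
    refine Finset.sum_nonpos fun i _ => ?_
    have := hmon _ (hy i) _ (hy j)
    rw [← mul_add]
    exact mul_nonpos_of_nonneg_of_nonpos (mul_nonneg (hm0 j) (hm0 i)) (by linarith)
  linarith

/-- A strongly monotone equilibrium problem is solvable: the approximate solutions for finite sets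
of test points stay in a fixed ball, and Minty's lemma applies to a common point of the
corresponding sublevel sets. -/
theorem EP_nonempty_of_strongly_monotone [CompleteSpace E] (hconv : IsTwoUniformlyConvex E)
    {C : Set E} (hCne : C.Nonempty) (hCcl : IsClosed C) (hC : Convex ℝ C) {h : E → E → ℝ}
    (hh : CondA h C) {ν : ℝ} (hν : 0 < ν)
    (hmon : ∀ x ∈ C, ∀ y ∈ C, h x y + h y x ≤ -(2 * ν * ‖x - y‖ ^ 2)) : (EP h C).Nonempty := by
  classical
  obtain ⟨y₀, hy₀⟩ := hCne
  obtain ⟨B, hB, hmin⟩ := exists_linear_minorant (hh.convex y₀ hy₀) (hh.lsc y₀ hy₀) hy₀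
    (hh.diag y₀ hy₀)
  set K : C × {ε : ℝ // 0 < ε} → Set E := fun q => {z | z ∈ C ∧ h q.1 z ≤ q.2} with hK
  obtain ⟨z, hz⟩ : ∃ z, ∀ q, z ∈ K q := by
    refine exists_forall_mem_of_finite_inter hconv (R := ‖y₀‖ + ((2 + B) / ν + 1))
      (fun q => isClosed_setOf_le_of_lowerSemicontinuousOn hCcl (hh.lsc _ q.1.2) _)
      (fun q => (hh.convex _ q.1.2).convex_le _) fun s => ?_
    obtain ⟨ε, hε, hεs⟩ : ∃ ε : ℝ, 0 < ε ∧ ε ≤ 1 ∧ ∀ q ∈ s, ε ≤ q.2 := by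
      induction s using Finset.induction_on with
      | empty => exact ⟨1, one_pos, le_rfl, by simp⟩
      | insert q s _ ih =>
        obtain ⟨ε, hε, hε1, hεs⟩ := ih
        refine ⟨min ε q.2, lt_min hε q.2.2, (min_le_left _ _).trans hε1, fun q' hq' => ?_⟩
        rcases Finset.mem_insert.1 hq' with rfl | hq'
        · exact min_le_right _ _
        · exact (min_le_left _ _).trans (hεs q' hq')
    obtain ⟨z, hzC, hz⟩ := exists_approx_minty ⟨y₀, hy₀⟩ hC hh.convex hν hmon
      (ι := Option s) (fun o => o.elim y₀ fun q => q.1.1)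
      (fun o => by cases o with
        | none => exact hy₀
        | some q => exact q.1.1.2) hε
    refine ⟨z, ?_, fun q hq => ⟨hzC, ?_⟩⟩
    · have h1 := hz none
      have h2 := hmin z hzC
      simp only [Option.elim] at h1
      have h3 : ‖z - y₀‖ ≤ (2 + B) / ν + 1 := by
        by_contra hcon
        rw [not_le] at hcon
        set d := ‖z - y₀‖
        have hd1 : 1 ≤ d := by
          have : 0 ≤ (2 + B) / ν := by positivity
          linarith
        have h4 : (2 + B) < ν * d := by
          have : (2 + B) / ν < d := by linarith
          rw [div_lt_iff₀ hν] at this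
          linarith
        nlinarith [hεs.1]
      calc ‖z‖ = ‖y₀ + (z - y₀)‖ := by rw [add_sub_cancel]
        _ ≤ ‖y₀‖ + ‖z - y₀‖ := norm_add_le _ _
        _ ≤ _ := by gcongr
    · have h1 := hz (some ⟨q, hq⟩)
      simp only [Option.elim] at h1
      have h2 : 0 ≤ ν * ‖z - q.1‖ ^ 2 := by positivity
      have h3 := hεs.2 q hq
      linarith
  have hzC : z ∈ C := (hz (⟨y₀, hy₀⟩, ⟨1, one_pos⟩)).1
  refine ⟨z, mem_EP_of_forall_le hC hh hzC fun y hy => ?_⟩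
  refine le_of_forall_pos_le_add fun ε hε => ?_
  rw [zero_add]
  exact (hz (⟨y, hy⟩, ⟨ε, hε⟩)).2

theorem condA_regularized (hs : IsUniformlySmooth E) {C : Set E} {f : E → E → ℝ} (hf : CondA f C)
    (hC : Convex ℝ C) {r : ℝ} (hr : 0 < r) (x : E) :
    CondA (fun z y => f z y + 1 / r * (J z - J x) (y - z)) C where
  diag z hz := by simp [hf.diag z hz]
  monotone z hz y hy := by
    have h1 := hf.monotone z hz y hy
    have h2 := J_monotone z y
    have e : (J z - J x) (y - z) + (J y - J x) (z - y) = -((J z - J y) (z - y)) := by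
      simp only [sub_apply, map_sub]; ring
    have h3 : 1 / r * ((J z - J x) (y - z) + (J y - J x) (z - y)) ≤ 0 := by
      rw [e]
      exact mul_nonpos_of_nonneg_of_nonpos (by positivity) (neg_nonpos.2 h2)
    linarith
  limsup_le z hz y hy v hv := by
    have hm : Continuous fun t : ℝ => t • v + (1 - t) • z := by fun_prop
    have hc : Tendsto (fun t : ℝ => ((1 / r * (J (t • v + (1 - t) • z) - J x)
        (y - (t • v + (1 - t) • z)) : ℝ) : EReal)) (𝓝[>] 0)
        (𝓝 ((1 / r * (J z - J x) (y - z) : ℝ) : EReal)) := by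
      refine (continuous_coe_real_ereal.tendsto _).comp ?_
      have h1 := (hm.tendsto 0).mono_left (nhdsWithin_le_nhds (s := Ioi 0))
      rw [zero_smul, sub_zero, one_smul, zero_add] at h1
      have h2 := (((continuous_J hs).comp hm).tendsto 0).mono_left
        (nhdsWithin_le_nhds (s := Ioi 0))
      simp only [Function.comp, zero_smul, sub_zero, one_smul, zero_add] at h2
      exact (tendsto_clm_apply (h2.sub_const _) (h1.const_sub _)).const_mul _
    simp only [EReal.coe_add]
    refine (EReal.limsup_add_le (Or.inr ?_) (Or.inr ?_)).trans ?_
    · rw [hc.limsup_eq]; exact EReal.coe_ne_top _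
    · rw [hc.limsup_eq]; exact EReal.coe_ne_bot _
    · rw [hc.limsup_eq]
      exact add_le_add_left (hf.limsup_le z hz y hy v hv) _
  convex z hz := by
    refine (hf.convex z hz).add ⟨hC, fun a _ b _ s t _ _ hst => le_of_eq ?_⟩
    have e : s • a + t • b - z = s • (a - z) + t • (b - z) := by
      have : z = (s + t) • z := by rw [hst, one_smul]
      conv_lhs => rw [this]
      module
    dsimp only
    rw [e, map_add, map_smul, map_smul]
    simp only [smul_eq_mul]
    ring
  lsc z hz := by
    refine (hf.lsc z hz).add (ContinuousOn.lowerSemicontinuousOn ?_)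
    fun_prop

theorem exists_isResolvent [CompleteSpace E] (hs : IsUniformlySmooth E)
    (hconv : IsTwoUniformlyConvex E) {C : Set E} (hCne : C.Nonempty) (hCcl : IsClosed C)
    (hC : Convex ℝ C) {f : E → E → ℝ} (hf : CondA f C) {r : ℝ} (hr : 0 < r) (x : E) :
    ∃ z, IsResolvent f C r x z := by
  obtain ⟨μ, hμ, hφ⟩ := exists_mul_sq_le_phi hconv
  refine EP_nonempty_of_strongly_monotone hconv hCne hCcl hC (condA_regularized hs hf hC hr x)
    (ν := μ / (2 * r)) (by positivity) fun z hz y hy => ?_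
  have h1 := hf.monotone z hz y hy
  have e : (J z - J x) (y - z) + (J y - J x) (z - y) = -((J z - J y) (z - y)) := by
    simp only [sub_apply, map_sub]; ring
  have h2 : μ * ‖z - y‖ ^ 2 ≤ (J z - J y) (z - y) := by
    have h3 := phi_add_phi_swap z y
    have h4 := hφ z y
    have h5 := hφ y z
    rw [norm_sub_rev] at h5
    linarith
  have h3 : 1 / r * ((J z - J x) (y - z) + (J y - J x) (z - y)) ≤ 1 / r * -(μ * ‖z - y‖ ^ 2) := by
    rw [e]; gcongr
  have h4 : 2 * (μ / (2 * r)) * ‖z - y‖ ^ 2 = 1 / r * (μ * ‖z - y‖ ^ 2) := by field_simp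
  rw [h4]
  linarith

theorem IsResolvent.phi_add_phi_le {C : Set E} {f : E → E → ℝ} (hf : CondA f C) {r : ℝ}
    (hr : 0 < r) {x z p : E} (hz : IsResolvent f C r x z) (hp : p ∈ EP f C) :
    phi p z + phi z x ≤ phi p x := by
  have h1 := hz.2 p hp.1
  have h2 := hf.monotone z hz.1 p hp.1
  have h3 := hp.2 z hz.1
  have h4 : 0 ≤ 1 / r * (J z - J x) (p - z) := by linarith
  have h5 : 0 ≤ (J z - J x) (p - z) := nonneg_of_mul_nonneg_right h4 (by positivity)
  linarith [phi_three_point p z x]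

end Equilibrium

section Method

variable {E : Type*} [NormedAddCommGroup E] [NormedSpace ℝ E]

/-! ### One step of the method -/

/-- The projection step for an inverse-strongly-monotone operator brings `x` closer to the solutions
of the variational inequality. -/
theorem CondV.phi_projection_le (hs : IsUniformlySmooth E) {C : Set E} (hC : Convex ℝ C)
    {c : ℝ} (hcJ : ∀ x y : E, ‖x - y‖ ≤ 2 / c ^ 2 * ‖J x - J y‖)
    {A : E → StrongDual ℝ E} {α : ℝ} (hA : CondV A C α) {x p v y : E} (hx : x ∈ C)
    (hp : p ∈ VI A C) {l : ℝ} (hl : 0 < l) (hv : J v = J x - l • A x) (hy : IsGenProj C v y) :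
    phi p y ≤ phi p x - 2 * l * (α - 2 * l / c ^ 2) * ‖A x - A p‖ ^ 2 := by
  have h1 := hy.phi_add_phi_le hs hC hp.1
  have h2 := phi_nonneg y v
  have h3 := phi_three_point p v x
  have h4 := phi_nonneg v x
  have h5 : (J v - J x) (p - v) = l * A x (x - p) + l * A x (v - x) := by
    rw [hv]
    simp only [sub_apply, smul_apply, smul_eq_mul, map_sub]
    ring
  have h6 : α * ‖A x - A p‖ ^ 2 ≤ A x (x - p) := by
    have h61 := hA.ism x hx p hp.1
    have h62 := hp.2 x hx
    rw [sub_apply] at h61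
    linarith
  have h7 : -(2 * l / c ^ 2 * ‖A x - A p‖ ^ 2) ≤ A x (v - x) := by
    have h71 := (abs_le.1 ((Real.norm_eq_abs _).ge.trans ((A x).le_opNorm (v - x)))).1
    have h72 := hcJ v x
    rw [hv, sub_sub_cancel_left, norm_neg, norm_smul, Real.norm_of_nonneg hl.le] at h72
    have h73 := hA.bound x hx p hp
    have h74 : ‖A x‖ * ‖v - x‖ ≤ ‖A x‖ * (2 / c ^ 2 * (l * ‖A x‖)) := by gcongr
    have h75 : ‖A x‖ * (2 / c ^ 2 * (l * ‖A x‖)) = 2 * l / c ^ 2 * ‖A x‖ ^ 2 := by ring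
    have h76 : 2 * l / c ^ 2 * ‖A x‖ ^ 2 ≤ 2 * l / c ^ 2 * ‖A x - A p‖ ^ 2 := by gcongr
    linarith
  have h8 := mul_le_mul_of_nonneg_left h6 hl.le
  have h9 := mul_le_mul_of_nonneg_left h7 hl.le
  linarith

/-- The auxiliary points of one step of Method B, taken from the point `x` at stage `n`. -/
structure IsStep {M N K : ℕ} (C : Set E) (A : Fin M → E → StrongDual ℝ E) (S : Fin N → E → E)
    (f : Fin K → E → E → ℝ) (n : ℕ) (l r : ℝ) (w : Fin (N + 1) → ℝ) (x : E) (y : Fin M → E)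
    (i₀ : Fin M) (z : E) (u : Fin K → E) (k₀ : Fin K) : Prop where
  y_eq : ∀ i, ∃ v, J v = J x - l • A i x ∧ IsGenProj C v (y i)
  i_max : ∀ i, ‖y i - x‖ ≤ ‖y i₀ - x‖
  z_eq : J z = w 0 • J x + ∑ j : Fin N, w j.succ • J ((S j)^[n] (y i₀))
  u_eq : ∀ k, IsResolvent (f k) C r z (u k)
  k_max : ∀ k, ‖u k - x‖ ≤ ‖u k₀ - x‖

theorem exists_isStep [CompleteSpace E] (hs : IsUniformlySmooth E) (hconv : IsTwoUniformlyConvex E)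
    {C : Set E} (hCne : C.Nonempty) (hCcl : IsClosed C) (hC : Convex ℝ C) {M N K : ℕ}
    (hM : 1 ≤ M) (hK : 1 ≤ K) (A : Fin M → E → StrongDual ℝ E) (S : Fin N → E → E)
    {f : Fin K → E → E → ℝ} (hf : ∀ k, CondA (f k) C) (n : ℕ) (l : ℝ) {r : ℝ} (hr : 0 < r)
    (w : Fin (N + 1) → ℝ) (x : E) : ∃ y i₀ z u k₀, IsStep C A S f n l r w x y i₀ z u k₀ := by
  have : Nonempty (Fin M) := ⟨⟨0, hM⟩⟩
  have : Nonempty (Fin K) := ⟨⟨0, hK⟩⟩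
  have hsurj := J_surjective hs hconv
  choose v hv using fun i => hsurj (J x - l • A i x)
  choose y hy using fun i => exists_isGenProj hconv hCne hCcl hC (v i)
  obtain ⟨i₀, hi₀⟩ := Finite.exists_max fun i => ‖y i - x‖
  obtain ⟨z, hz⟩ := hsurj (w 0 • J x + ∑ j : Fin N, w j.succ • J ((S j)^[n] (y i₀)))
  choose u hu using fun k => exists_isResolvent hs hconv hCne hCcl hC (hf k) hr z
  obtain ⟨k₀, hk₀⟩ := Finite.exists_max fun k => ‖u k - x‖
  exact ⟨y, i₀, z, u, k₀, fun i => ⟨v i, hv i, hy i⟩, hi₀, hz, hu, hk₀⟩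

/-- The Lyapunov balance of one step with respect to a common solution. The terms on the left that
are dropped to see that a common solution stays in the next set are those whose decay identifies the
limit of the method. -/
theorem IsStep.phi_estimate (hs : IsUniformlySmooth E) {C : Set E} (hC : Convex ℝ C) {c : ℝ}
    (hcJ : ∀ x y : E, ‖x - y‖ ≤ 2 / c ^ 2 * ‖J x - J y‖) {M N K : ℕ}
    {A : Fin M → E → StrongDual ℝ E} {α : ℝ} (hA : ∀ i, CondV (A i) C α)
    {f : Fin K → E → E → ℝ} (hf : ∀ k, CondA (f k) C)
    {S : Fin N → E → E} {kn : ℕ → ℝ} (hkn : ∀ n, 1 ≤ kn n)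
    (hS : ∀ j, QuasiPhiAsymptoticallyNonexpansive (S j) C kn)
    {n : ℕ} {l r β ω : ℝ} {w : Fin (N + 1) → ℝ} (hw0 : ∀ j, 0 ≤ w j) (hw : ∑ j, w j = 1)
    (hl : 0 < l) (hβ0 : 0 ≤ β) (hβ : β ≤ 2 * l * (α - 2 * l / c ^ 2)) (hr : 0 < r)
    {x : E} (hx : x ∈ C) {y : Fin M → E} {i₀ : Fin M} {z : E} {u : Fin K → E} {k₀ : Fin K}
    (hstep : IsStep C A S f n l r w x y i₀ z u k₀) {p : E} (hp : p ∈ commonSolutions C A S f)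
    (hpω : ‖p‖ ≤ ω) :
    phi p (u k₀) + phi (u k₀) z + ∑ j : Fin N, w j.succ * phi z ((S j)^[n] (y i₀)) +
      (1 - w 0) * (β * ‖A i₀ x - A i₀ p‖ ^ 2) ≤ phi p x + (kn n - 1) * (ω + ‖x‖) ^ 2 := by
  obtain ⟨⟨hpV, hpS⟩, hpE⟩ := hp
  rw [mem_iInter] at hpV hpS hpE
  obtain ⟨v, hv, hyv⟩ := hstep.y_eq i₀
  have h1 := (hstep.u_eq k₀).phi_add_phi_le (hf k₀) hr (hpE k₀)
  have h2 := (hA i₀).phi_projection_le hs hC hcJ hx (hpV i₀) hl hv hyv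
  have h3 : β * ‖A i₀ x - A i₀ p‖ ^ 2 ≤
      2 * l * (α - 2 * l / c ^ 2) * ‖A i₀ x - A i₀ p‖ ^ 2 := by gcongr
  have h4 : 0 ≤ β * ‖A i₀ x - A i₀ p‖ ^ 2 := by positivity
  set G := β * ‖A i₀ x - A i₀ p‖ ^ 2
  have h5 : 0 ≤ phi p (y i₀) := phi_nonneg _ _
  have h6 : phi p x ≤ (ω + ‖x‖) ^ 2 := (phi_le_sq_add p x).trans (by gcongr)
  have hk : 0 ≤ kn n - 1 := sub_nonneg.2 (hkn n)
  set ε := (kn n - 1) * (ω + ‖x‖) ^ 2 with hε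
  have hε0 : 0 ≤ ε := by positivity
  have h7 : ∀ j, phi p ((S j)^[n] (y i₀)) ≤ phi p x - G + ε := by
    intro j
    have h71 : phi p ((S j)^[n] (y i₀)) ≤ kn n * phi p (y i₀) := by
      rcases Nat.eq_zero_or_pos n with rfl | hn
      · rw [Function.iterate_zero, id]
        exact le_mul_of_one_le_left h5 (hkn 0)
      · exact (hS j).phi_le n hn p (hpS j) _ hyv.1
    have h72 : (kn n - 1) * phi p (y i₀) ≤ ε := by
      rw [hε]
      gcongr
      linarith
    linarith
  have hsucc : ∑ j : Fin N, w j.succ = 1 - w 0 := by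
    rw [Fin.sum_univ_succ] at hw; linarith
  have h8 := sum_phi_eq w hw (Fin.cons x fun j => (S j)^[n] (y i₀) : Fin (N + 1) → E) p z (by
    rw [hstep.z_eq, Fin.sum_univ_succ]; simp only [Fin.cons_zero, Fin.cons_succ])
  rw [Fin.sum_univ_succ, Fin.sum_univ_succ] at h8
  simp only [Fin.cons_zero, Fin.cons_succ] at h8
  have h9 : ∑ j : Fin N, w j.succ * phi p ((S j)^[n] (y i₀)) ≤
      ∑ j : Fin N, w j.succ * (phi p x - G + ε) :=
    Finset.sum_le_sum fun j _ => mul_le_mul_of_nonneg_left (h7 j) (hw0 _)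
  rw [← Finset.sum_mul, hsucc] at h9
  have h10 : 0 ≤ w 0 * phi z x := mul_nonneg (hw0 0) (phi_nonneg _ _)
  have h11 : 0 ≤ w 0 * ε := mul_nonneg (hw0 0) hε0
  linarith

theorem isClosed_convex_setOf_phi_le {D : Set E} (hcl : IsClosed D) (hcv : Convex ℝ D) (u x : E)
    (ε : ℝ) : IsClosed {v | v ∈ D ∧ phi v u ≤ phi v x + ε} ∧
      Convex ℝ {v | v ∈ D ∧ phi v u ≤ phi v x + ε} := by
  -- the defining inequality is affine in `v`
  have e : {v | v ∈ D ∧ phi v u ≤ phi v x + ε} =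
      D ∩ {v | (J x - J u) v ≤ (ε + ‖x‖ ^ 2 - ‖u‖ ^ 2) / 2} := by
    ext v
    simp only [phi, mem_inter_iff, mem_ofPred_eq, sub_apply]
    refine and_congr_right fun _ => ⟨fun h => ?_, fun h => ?_⟩ <;> linarith
  rw [e]
  exact ⟨hcl.inter (isClosed_le (J x - J u).continuous continuous_const),
    hcv.inter (convex_halfSpace_le (J x - J u).toLinearMap.isLinear _)⟩

/-! ### Passing to the limit -/

omit [NormedSpace ℝ E] in
theorem tendsto_of_norm_sub_le {x y : ℕ → E} {p : E} {c : ℕ → ℝ}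
    (hx : Tendsto x atTop (𝓝 p)) (h : ∀ᶠ n in atTop, ‖y n - x n‖ ≤ c n)
    (hc : Tendsto c atTop (𝓝 0)) : Tendsto y atTop (𝓝 p) := by
  have h1 : Tendsto (fun n => y n - x n) atTop (𝓝 0) := squeeze_zero_norm' h hc
  simpa using h1.add hx

theorem tendsto_of_phi_le (hconv : IsTwoUniformlyConvex E) {x y : ℕ → E} {p : E} {c : ℕ → ℝ}
    (hx : Tendsto x atTop (𝓝 p))
    (h : ∀ᶠ n in atTop, phi (x n) (y n) ≤ c n ∨ phi (y n) (x n) ≤ c n)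
    (hc : Tendsto c atTop (𝓝 0)) : Tendsto y atTop (𝓝 p) := by
  obtain ⟨μ, hμ, hφ⟩ := exists_mul_sq_le_phi hconv
  refine tendsto_of_norm_sub_le hx (c := fun n => √(μ⁻¹ * c n)) ?_ ?_
  · filter_upwards [h] with n hn
    refine Real.le_sqrt_of_sq_le ?_
    rw [← div_eq_inv_mul, le_div_iff₀ hμ]
    have h1 := hφ (x n) (y n)
    have h2 := hφ (y n) (x n)
    rw [norm_sub_rev] at h1
    rcases hn with hn | hn <;> linarith
  · simpa using (hc.const_mul μ⁻¹).sqrt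

theorem CondV.tendsto {C : Set E} {A : E → StrongDual ℝ E} {α : ℝ} (hα : 0 < α)
    (hA : CondV A C α) {x : ℕ → E} {p : E} (hx : ∀ n, x n ∈ C) (hp : p ∈ C)
    (hlim : Tendsto x atTop (𝓝 p)) : Tendsto (fun n => A (x n)) atTop (𝓝 (A p)) := by
  have h1 : Tendsto (fun n => α⁻¹ * ‖x n - p‖) atTop (𝓝 0) := by
    simpa using (tendsto_iff_norm_sub_tendsto_zero.1 hlim).const_mul α⁻¹
  rw [tendsto_iff_norm_sub_tendsto_zero]
  refine squeeze_zero (fun _ => norm_nonneg _) (fun n => ?_) h1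
  rw [← div_eq_inv_mul, le_div_iff₀ hα]
  have h2 := hA.ism (x n) (hx n) p hp
  have h3 := (le_abs_self _).trans ((A (x n) - A p).le_opNorm (x n - p))
  rcases (norm_nonneg (A (x n) - A p)).eq_or_lt with h0 | h0
  · rw [← h0, zero_mul]; exact norm_nonneg _
  · have h4 : ‖A (x n) - A p‖ * (‖A (x n) - A p‖ * α) ≤ ‖A (x n) - A p‖ * ‖x n - p‖ := by
      linarith
    exact le_of_mul_le_mul_left h4 h0

/-- A common limit of points and of their projection steps solves the variational inequality. -/
theorem CondV.mem_VI_of_tendsto (hs : IsUniformlySmooth E) {C : Set E} (hC : Convex ℝ C)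
    {A : E → StrongDual ℝ E} {α : ℝ} (hα : 0 < α) (hA : CondV A C α) {x y : ℕ → E} {p : E}
    (hx : ∀ n, x n ∈ C) (hp : p ∈ C) (hxp : Tendsto x atTop (𝓝 p)) (hyp : Tendsto y atTop (𝓝 p))
    {l : ℕ → ℝ} {a : ℝ} (ha : 0 < a) (hl : ∀ n, a ≤ l n)
    (hy : ∀ n, ∃ v, J v = J (x n) - l n • A (x n) ∧ IsGenProj C v (y n)) : p ∈ VI A C := by
  refine ⟨hp, fun q hq => ?_⟩
  have hJx := ((continuous_J hs).tendsto p).comp hxp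
  have hJy := ((continuous_J hs).tendsto p).comp hyp
  have h1 := tendsto_clm_apply (hJy.sub hJx) (hyp.const_sub q)
  rw [sub_self, zero_apply] at h1
  have h2 : Tendsto (fun n => -(a⁻¹ * |(J (y n) - J (x n)) (q - y n)|)) atTop (𝓝 0) := by
    simpa using (h1.abs.const_mul a⁻¹).neg
  have h3 := tendsto_clm_apply (hA.tendsto hα hx hp hxp) (hyp.const_sub q)
  refine le_of_tendsto_of_tendsto' h2 h3 fun n => ?_
  obtain ⟨v, hv, hyv⟩ := hy n
  have h4 := hyv.variational hs hC hq
  have h5 : (J (y n) - J v) (q - y n) =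
      (J (y n) - J (x n)) (q - y n) + l n * A (x n) (q - y n) := by
    rw [hv]; simp only [sub_apply, smul_apply, smul_eq_mul]; ring
  rw [h5] at h4
  have hln : 0 < l n := ha.trans_le (hl n)
  have h6 : (l n)⁻¹ * |(J (y n) - J (x n)) (q - y n)| ≤
      a⁻¹ * |(J (y n) - J (x n)) (q - y n)| := by
    gcongr; exact hl n
  have h7 : -((l n)⁻¹ * |(J (y n) - J (x n)) (q - y n)|) ≤ A (x n) (q - y n) := by
    rw [neg_le, ← div_eq_inv_mul, le_div_iff₀ hln]
    linarith [le_abs_self ((J (y n) - J (x n)) (q - y n))]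
  linarith

omit [NormedSpace ℝ E] in
theorem mem_Fix_of_tendsto {C : Set E} {S : E → E} (hmaps : MapsTo S C C) {L : ℝ}
    (hSL : UniformlyLipschitz S C L) {y : ℕ → E} {p : E} (hy : ∀ n, y n ∈ C) (hp : p ∈ C)
    (hyp : Tendsto y atTop (𝓝 p)) (hSy : Tendsto (fun n => S^[n] (y n)) atTop (𝓝 p)) :
    p ∈ Fix S C := by
  have h1 : Tendsto (fun n => L * ‖y n - p‖) atTop (𝓝 0) := by
    simpa using (tendsto_iff_norm_sub_tendsto_zero.1 hyp).const_mul L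
  have h2 : Tendsto (fun n => S^[n] p) atTop (𝓝 p) := by
    refine tendsto_of_norm_sub_le hSy ?_ h1
    filter_upwards [eventually_ge_atTop 1] with n hn
    rw [norm_sub_rev]
    exact hSL n hn _ (hy n) _ hp
  have h3 : Tendsto (fun n => L * ‖S^[n] p - p‖) atTop (𝓝 0) := by
    simpa using (tendsto_iff_norm_sub_tendsto_zero.1 h2).const_mul L
  have h4 : Tendsto (fun n => S^[n + 1] p) atTop (𝓝 (S p)) := by
    rw [tendsto_iff_norm_sub_tendsto_zero]
    refine squeeze_zero (fun _ => norm_nonneg _) (fun n => ?_) h3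
    rw [Function.iterate_succ_apply']
    simpa using hSL 1 le_rfl _ (hmaps.iterate n hp) _ hp
  exact ⟨hp, tendsto_nhds_unique h4 (h2.comp (tendsto_add_atTop_nat 1))⟩

theorem CondA.mem_EP_of_tendsto (hs : IsUniformlySmooth E) {C : Set E} (hC : Convex ℝ C)
    {f : E → E → ℝ} (hf : CondA f C) {u z : ℕ → E} {p : E} (hp : p ∈ C)
    (hup : Tendsto u atTop (𝓝 p)) (hzp : Tendsto z atTop (𝓝 p)) {r : ℕ → ℝ} {d : ℝ} (hd : 0 < d)
    (hr : ∀ n, d ≤ r n) (hu : ∀ n, IsResolvent f C (r n) (z n) (u n)) : p ∈ EP f C := by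
  refine mem_EP_of_forall_le hC hf hp fun y hy => ?_
  have h1 := tendsto_clm_apply ((((continuous_J hs).tendsto p).comp hup).sub
    (((continuous_J hs).tendsto p).comp hzp)) (hup.const_sub y)
  rw [sub_self, zero_apply] at h1
  have h2 : Tendsto (fun n => 1 / d * |(J (u n) - J (z n)) (y - u n)|) atTop (𝓝 0) := by
    simpa using h1.abs.const_mul (1 / d)
  refine le_of_lowerSemicontinuousOn (hf.lsc y hy) (fun n => (hu n).1) hp hup h2 fun n => ?_
  have h3 := (hu n).2 y hy
  have h4 := hf.monotone y hy (u n) (hu n).1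
  have hrn : 0 < r n := hd.trans_le (hr n)
  have h5 : 1 / r n * (J (u n) - J (z n)) (y - u n) ≤
      1 / d * |(J (u n) - J (z n)) (y - u n)| := by
    have h51 : 1 / r n * (J (u n) - J (z n)) (y - u n) ≤
        1 / r n * |(J (u n) - J (z n)) (y - u n)| := by
      gcongr; exact le_abs_self _
    refine h51.trans ?_
    gcongr; exact hr n
  linarith

/-! ### Runs of the method -/

variable {M N K : ℕ} {C : Set E} {A : Fin M → E → StrongDual ℝ E}
    {S : Fin N → E → E} {f : Fin K → E → E → ℝ} {kn : ℕ → ℝ} {ω : ℝ} {lam r : ℕ → ℝ}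
    {w : ℕ → Fin (N + 1) → ℝ} {x₀ : E} {x : ℕ → E} {y : ℕ → Fin M → E} {iMax : ℕ → Fin M}
    {z : ℕ → E} {u : ℕ → Fin K → E} {kMax : ℕ → Fin K} {D : ℕ → Set E}

theorem IsMethodBRun.isStep
    (h : IsMethodBRun C A S f kn ω lam r w x₀ x y iMax z u kMax D) (n : ℕ) :
    IsStep C A S f n (lam n) (r n) (w n) (x n) (y n) (iMax n) (z n) (u n) (kMax n) :=
  ⟨h.y_eq n, h.iMax_max n, h.z_eq n, h.u_eq n, h.kMax_max n⟩

theorem IsMethodBRun.antitone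
    (h : IsMethodBRun C A S f kn ω lam r w x₀ x y iMax z u kMax D) : Antitone D :=
  antitone_nat_of_succ_le fun n => by
    rw [h.D_succ n]; exact sep_subset _ _

theorem IsMethodBRun.isClosed_convex (hCcl : IsClosed C) (hC : Convex ℝ C)
    (h : IsMethodBRun C A S f kn ω lam r w x₀ x y iMax z u kMax D) (n : ℕ) :
    IsClosed (D n) ∧ Convex ℝ (D n) := by
  induction n with
  | zero => rw [h.D_zero]; exact ⟨hCcl, hC⟩
  | succ n ih => rw [h.D_succ]; exact isClosed_convex_setOf_phi_le ih.1 ih.2 _ _ _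

theorem IsMethodBRun.isGenProj (hx₀ : x₀ ∈ C)
    (h : IsMethodBRun C A S f kn ω lam r w x₀ x y iMax z u kMax D) (n : ℕ) :
    IsGenProj (D n) x₀ (x n) := by
  cases n with
  | zero =>
    rw [h.D_zero, h.x_zero]
    exact ⟨hx₀, fun q _ => by rw [phi_self]; exact phi_nonneg _ _⟩
  | succ n => exact h.x_succ n

end Method

section Main

variable {E : Type*} [NormedAddCommGroup E] [NormedSpace ℝ E]

/-! ### Existence of runs -/

theorem exists_isMethodBRun [CompleteSpace E] (hs : IsUniformlySmooth E)
    (hconv : IsTwoUniformlyConvex E) {C : Set E} (hCcl : IsClosed C) (hC : Convex ℝ C) {M N K : ℕ}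
    (hM : 1 ≤ M) (hK : 1 ≤ K) {A : Fin M → E → StrongDual ℝ E} {S : Fin N → E → E}
    {f : Fin K → E → E → ℝ} (hf : ∀ k, CondA (f k) C)
    (hFne : (commonSolutions C A S f).Nonempty) (hFC : commonSolutions C A S f ⊆ C) {kn : ℕ → ℝ}
    {ω : ℝ} {lam r : ℕ → ℝ} (hr : ∀ n, 0 < r n) {w : ℕ → Fin (N + 1) → ℝ}
    (hF : ∀ n x y i₀ z u k₀, x ∈ C → IsStep C A S f n (lam n) (r n) (w n) x y i₀ z u k₀ →
      ∀ p ∈ commonSolutions C A S f, phi p (u k₀) ≤ phi p x + (kn n - 1) * (ω + ‖x‖) ^ 2)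
    {x₀ : E} (hx₀ : x₀ ∈ C) : ∃ x, GeneratedByMethodB C A S f kn ω lam r w x₀ x := by
  -- the state after `n` steps is the pair of the iterate and the current set
  let T := {q : E × Set E // q.1 ∈ C ∧ q.2 ⊆ C ∧ IsClosed q.2 ∧ Convex ℝ q.2 ∧
    commonSolutions C A S f ⊆ q.2}
  have hstep : ∀ (n : ℕ) (q : T), ∃ y i₀ z u k₀, ∃ q' : T,
      IsStep C A S f n (lam n) (r n) (w n) q.1.1 y i₀ z u k₀ ∧
      q'.1.2 = {v ∈ q.1.2 | phi v (u k₀) ≤ phi v q.1.1 + (kn n - 1) * (ω + ‖q.1.1‖) ^ 2} ∧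
      IsGenProj q'.1.2 x₀ q'.1.1 := by
    rintro n ⟨⟨x, D⟩, hxC, hDC, hDcl, hDcv, hFD⟩
    obtain ⟨y, i₀, z, u, k₀, h⟩ :=
      exists_isStep hs hconv ⟨x₀, hx₀⟩ hCcl hC hM hK A S hf n (lam n) (hr n) (w n) x
    obtain ⟨hcl, hcv⟩ := isClosed_convex_setOf_phi_le hDcl hDcv (u k₀) x
      ((kn n - 1) * (ω + ‖x‖) ^ 2)
    have hFD' : commonSolutions C A S f ⊆
        {v ∈ D | phi v (u k₀) ≤ phi v x + (kn n - 1) * (ω + ‖x‖) ^ 2} :=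
      fun p hp => ⟨hFD hp, hF n x y i₀ z u k₀ hxC h p hp⟩
    obtain ⟨x', hx'⟩ := exists_isGenProj hconv (hFne.mono hFD') hcl hcv x₀
    exact ⟨y, i₀, z, u, k₀, ⟨⟨x', _⟩, hDC hx'.1.1, fun v hv => hDC hv.1, hcl, hcv, hFD'⟩,
      h, rfl, hx'⟩
  choose y i₀ z u k₀ next h hD hx using hstep
  let st : ℕ → T := fun n => Nat.rec ⟨(x₀, C), hx₀, Subset.rfl, hCcl, hC, hFC⟩ (fun n q => next n q) n
  exact ⟨fun n => (st n).1.1, fun n => y n (st n), fun n => i₀ n (st n), fun n => z n (st n),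
    fun n => u n (st n), fun n => k₀ n (st n), fun n => (st n).1.2,
    { x_zero := rfl
      D_zero := rfl
      y_eq := fun n => (h n (st n)).y_eq
      iMax_max := fun n => (h n (st n)).i_max
      z_eq := fun n => (h n (st n)).z_eq
      u_eq := fun n => (h n (st n)).u_eq
      kMax_max := fun n => (h n (st n)).k_max
      D_succ := fun n => hD n (st n)
      x_succ := fun n => hx n (st n) }⟩

/-! ### Convergence of runs -/

/-- Every run converges, and its limit is the generalized projection of the starting point onto the
intersection of all the sets of the run. -/
theorem IsMethodBRun.exists_tendsto [CompleteSpace E] (hs : IsUniformlySmooth E)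
    (hconv : IsTwoUniformlyConvex E) {C : Set E} (hCcl : IsClosed C) (hC : Convex ℝ C)
    {M N K : ℕ} {A : Fin M → E → StrongDual ℝ E} {S : Fin N → E → E} {f : Fin K → E → E → ℝ}
    {kn : ℕ → ℝ} {ω : ℝ} {lam r : ℕ → ℝ} {w : ℕ → Fin (N + 1) → ℝ} {x₀ : E} (hx₀ : x₀ ∈ C)
    {x : ℕ → E} {y : ℕ → Fin M → E} {iMax : ℕ → Fin M} {z : ℕ → E} {u : ℕ → Fin K → E}
    {kMax : ℕ → Fin K} {D : ℕ → Set E}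
    (h : IsMethodBRun C A S f kn ω lam r w x₀ x y iMax z u kMax D) (hne : (⋂ n, D n).Nonempty) :
    ∃ p, Tendsto x atTop (𝓝 p) ∧ IsGenProj (⋂ n, D n) x₀ p := by
  obtain ⟨ν, hν, hgrow⟩ := exists_quadratic_growth_phi hconv
  have hproj := h.isGenProj hx₀
  have hcc := h.isClosed_convex hCcl hC
  obtain ⟨p₀, hp₀⟩ := hne
  rw [mem_iInter] at hp₀
  obtain ⟨p, hp⟩ : ∃ p, Tendsto x atTop (𝓝 p) := by
    refine exists_tendsto_of_sq_le (a := fun n => phi (x n) x₀) hν ⟨phi p₀ x₀, ?_⟩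
      fun n m hnm => hgrow _ _ _ (hcc n).2 (hproj n) _ (h.antitone hnm (hproj m).1)
    rintro _ ⟨n, rfl⟩
    exact (hproj n).2 p₀ (hp₀ n)
  refine ⟨p, hp, mem_iInter.2 fun n => (hcc n).1.mem_of_tendsto hp ?_, fun v hv => ?_⟩
  · filter_upwards [eventually_ge_atTop n] with m hm
    exact h.antitone hm (hproj m).1
  · exact le_of_tendsto' (tendsto_phi hs hp tendsto_const_nhds) fun n =>
      (hproj n).2 v (mem_iInter.1 hv n)

theorem exists_pos_forall_eventually_le {N : ℕ} {w : ℕ → Fin (N + 1) → ℝ}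
    (hw01 : ∀ n j, w n j ∈ Icc (0 : ℝ) 1) {j : Fin N}
    (h : 0 < liminf (fun n => w n 0 * w n j.succ) atTop) :
    ∃ c, 0 < c ∧ ∀ᶠ n in atTop, c ≤ w n j.succ := by
  obtain ⟨c, hc0, hc⟩ := exists_between h
  have hbdd : IsBoundedUnder (· ≥ ·) atTop fun n => w n 0 * w n j.succ :=
    isBoundedUnder_of ⟨0, fun n => mul_nonneg (hw01 n 0).1 (hw01 n _).1⟩
  refine ⟨c, hc0, (eventually_lt_of_lt_liminf hc hbdd).mono fun n hn => ?_⟩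
  exact hn.le.trans (mul_le_of_le_one_left (hw01 n _).1 (hw01 n 0).2)

/-- The limit of a run is a common solution. -/
theorem IsMethodBRun.limit_mem_commonSolutions (hs : IsUniformlySmooth E)
    (hconv : IsTwoUniformlyConvex E) {C : Set E} (hCcl : IsClosed C) (hC : Convex ℝ C)
    {M N K : ℕ} (hN : 1 ≤ N) {α : ℝ} (hα : 0 < α) {A : Fin M → E → StrongDual ℝ E}
    (hA : ∀ i, CondV (A i) C α) {S : Fin N → E → E} {f : Fin K → E → E → ℝ}
    (hf : ∀ k, CondA (f k) C) {kn : ℕ → ℝ} {L : ℝ} (hSL : ∀ j, UniformlyLipschitz (S j) C L)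
    (hS : ∀ j, QuasiPhiAsymptoticallyNonexpansive (S j) C kn) {ω : ℝ} {lam r : ℕ → ℝ}
    {w : ℕ → Fin (N + 1) → ℝ} (hw01 : ∀ n j, w n j ∈ Icc (0 : ℝ) 1) (hwsum : ∀ n, ∑ j, w n j = 1)
    (hwliminf : ∀ j : Fin N, 0 < liminf (fun n => w n 0 * w n j.succ) atTop)
    {c : ℝ} (hcJ : ∀ x y : E, ‖x - y‖ ≤ 2 / c ^ 2 * ‖J x - J y‖) {a b β d : ℝ} (ha : 0 < a)
    (hlam : ∀ n, lam n ∈ Icc a b) (hβ : 0 < β) (hd : 0 < d) (hr : ∀ n, d ≤ r n) {x₀ : E}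
    (hx₀ : x₀ ∈ C) {x : ℕ → E} {y : ℕ → Fin M → E} {iMax : ℕ → Fin M} {z : ℕ → E}
    {u : ℕ → Fin K → E} {kMax : ℕ → Fin K} {D : ℕ → Set E}
    (h : IsMethodBRun C A S f kn ω lam r w x₀ x y iMax z u kMax D) {p₀ : E}
    (hp₀ : p₀ ∈ commonSolutions C A S f)
    (hest : ∀ n, phi p₀ (u n (kMax n)) + phi (u n (kMax n)) (z n) +
      ∑ j : Fin N, w n j.succ * phi (z n) ((S j)^[n] (y n (iMax n))) +
      (1 - w n 0) * (β * ‖A (iMax n) (x n) - A (iMax n) p₀‖ ^ 2) ≤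
        phi p₀ (x n) + (kn n - 1) * (ω + ‖x n‖) ^ 2)
    {p : E} (hp : Tendsto x atTop (𝓝 p)) : p ∈ commonSolutions C A S f := by
  obtain ⟨⟨hpV, -⟩, -⟩ := hp₀
  rw [mem_iInter] at hpV
  have hw0 : ∀ n j, 0 ≤ w n j := fun n j => (hw01 n j).1
  have hsucc : ∀ n, ∑ j : Fin N, w n j.succ = 1 - w n 0 := fun n => by
    have := hwsum n
    rw [Fin.sum_univ_succ] at this; linarith
  have hxC : ∀ n, x n ∈ C := fun n => by
    have := h.antitone (Nat.zero_le n) (h.isGenProj hx₀ n).1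
    rwa [h.D_zero] at this
  have hpC : p ∈ C := hCcl.mem_of_tendsto hp (Eventually.of_forall hxC)
  set ε : ℕ → ℝ := fun n => (kn n - 1) * (ω + ‖x n‖) ^ 2 with hε
  have hεlim : Tendsto ε atTop (𝓝 0) := by
    have h1 := (((hS ⟨0, hN⟩).tendsto).sub_const 1).mul ((hp.norm.const_add ω).pow 2)
    rwa [sub_self, zero_mul] at h1
  -- the points `u n k` approach the iterates
  have hp1 : Tendsto (fun n => x (n + 1)) atTop (𝓝 p) := hp.comp (tendsto_add_atTop_nat 1)
  have hubar : Tendsto (fun n => u n (kMax n)) atTop (𝓝 p) := by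
    refine tendsto_of_phi_le hconv hp1 (c := fun n => phi (x (n + 1)) (x n) + ε n)
      (Eventually.of_forall fun n => Or.inl ?_) ?_
    · have := (h.x_succ n).1
      rw [h.D_succ n] at this
      exact this.2
    · have := (tendsto_phi hs hp1 hp).add hεlim
      rwa [phi_self, add_zero] at this
  have hu : ∀ k, Tendsto (fun n => u n k) atTop (𝓝 p) := fun k => by
    refine tendsto_of_norm_sub_le hp (Eventually.of_forall fun n => h.kMax_max n k) ?_
    simpa using (hubar.sub hp).norm
  -- the defect in the Lyapunov balance tends to zero
  set G : ℕ → ℝ := fun n => phi p₀ (x n) + ε n - phi p₀ (u n (kMax n)) with hG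
  have hGlim : Tendsto G atTop (𝓝 0) := by
    have := ((tendsto_phi hs (tendsto_const_nhds (x := p₀)) hp).add hεlim).sub
      (tendsto_phi hs (tendsto_const_nhds (x := p₀)) hubar)
    rwa [add_zero, sub_self] at this
  have hterm : ∀ n j, 0 ≤ w n j.succ * phi (z n) ((S j)^[n] (y n (iMax n))) := fun n j =>
    mul_nonneg (hw0 n _) (phi_nonneg _ _)
  have hsum0 : ∀ n, 0 ≤ ∑ j : Fin N, w n j.succ * phi (z n) ((S j)^[n] (y n (iMax n))) :=
    fun n => Finset.sum_nonneg fun j _ => hterm n j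
  have hA0 : ∀ n, 0 ≤ (1 - w n 0) * (β * ‖A (iMax n) (x n) - A (iMax n) p₀‖ ^ 2) := fun n =>
    mul_nonneg (sub_nonneg.2 (hw01 n 0).2) (by positivity)
  have hz : Tendsto z atTop (𝓝 p) := by
    refine tendsto_of_phi_le hconv hubar (Eventually.of_forall fun n => Or.inl ?_) hGlim
    have h1 := hest n
    have h2 := hsum0 n
    have h3 := hA0 n
    simp only [hG, hε]
    linarith
  have hSy : ∀ j, Tendsto (fun n => (S j)^[n] (y n (iMax n))) atTop (𝓝 p) := fun j => by
    obtain ⟨e, he, hev⟩ := exists_pos_forall_eventually_le hw01 (hwliminf j)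
    refine tendsto_of_phi_le hconv hz (c := fun n => e⁻¹ * G n) ?_ (by
      simpa using hGlim.const_mul e⁻¹)
    filter_upwards [hev] with n hn
    left
    rw [← div_eq_inv_mul, le_div_iff₀ he]
    have h1 := hest n
    have h2 : w n j.succ * phi (z n) ((S j)^[n] (y n (iMax n))) ≤
        ∑ j : Fin N, w n j.succ * phi (z n) ((S j)^[n] (y n (iMax n))) :=
      Finset.single_le_sum (fun j _ => hterm n j) (Finset.mem_univ j)
    have h3 := hA0 n
    have h4 := phi_nonneg (u n (kMax n)) (z n)
    have h5 := mul_le_mul_of_nonneg_right hn (phi_nonneg (z n) ((S j)^[n] (y n (iMax n))))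
    simp only [hG, hε]
    linarith
  have hAlim : Tendsto (fun n => ‖A (iMax n) (x n)‖ ^ 2) atTop (𝓝 0) := by
    obtain ⟨e, he, hev⟩ := exists_pos_forall_eventually_le hw01 (hwliminf ⟨0, hN⟩)
    refine squeeze_zero' (g := fun n => (e * β)⁻¹ * G n) (Eventually.of_forall fun n => sq_nonneg _)
      ?_ (by simpa using hGlim.const_mul (e * β)⁻¹)
    filter_upwards [hev] with n hn
    rw [← div_eq_inv_mul, le_div_iff₀ (by positivity)]
    have h1 := hest n
    have h2 := hsum0 n
    have h4 := phi_nonneg (u n (kMax n)) (z n)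
    have h5 : e ≤ 1 - w n 0 := by
      rw [← hsucc n]
      exact hn.trans (Finset.single_le_sum (f := fun j : Fin N => w n j.succ)
        (fun j _ => hw0 n _) (Finset.mem_univ _))
    have h6 : ‖A (iMax n) (x n)‖ ^ 2 ≤ ‖A (iMax n) (x n) - A (iMax n) p₀‖ ^ 2 := by
      gcongr
      exact (hA _).bound _ (hxC n) _ (hpV _)
    have h7 : ‖A (iMax n) (x n)‖ ^ 2 * (e * β) ≤
        (1 - w n 0) * (β * ‖A (iMax n) (x n) - A (iMax n) p₀‖ ^ 2) := by
      calc ‖A (iMax n) (x n)‖ ^ 2 * (e * β) = e * (β * ‖A (iMax n) (x n)‖ ^ 2) := by ring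
        _ ≤ _ := by gcongr; linarith
    simp only [hG, hε]
    linarith
  have hAlim' : Tendsto (fun n => ‖A (iMax n) (x n)‖) atTop (𝓝 0) := by
    simpa [Real.sqrt_sq (norm_nonneg _)] using hAlim.sqrt
  -- the points `y n i` approach the iterates
  have hb : 0 ≤ b := ha.le.trans ((hlam 0).1.trans (hlam 0).2)
  choose v hv hyv using h.y_eq
  have hvn : ∀ n, ‖x n - v n (iMax n)‖ ≤ 2 / c ^ 2 * (b * ‖A (iMax n) (x n)‖) := fun n => by
    have h1 := hcJ (x n) (v n (iMax n))
    have hl := ha.le.trans (hlam n).1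
    rw [hv, sub_sub_cancel, norm_smul, Real.norm_of_nonneg hl] at h1
    refine h1.trans ?_
    gcongr
    exact (hlam n).2
  have hvlim : Tendsto (fun n => v n (iMax n)) atTop (𝓝 p) := by
    refine tendsto_of_norm_sub_le hp (Eventually.of_forall fun n => ?_)
      (c := fun n => 2 / c ^ 2 * (b * ‖A (iMax n) (x n)‖)) ?_
    · rw [norm_sub_rev]; exact hvn n
    · simpa using (hAlim'.const_mul b).const_mul (2 / c ^ 2)
  have hybar : Tendsto (fun n => y n (iMax n)) atTop (𝓝 p) := by
    refine tendsto_of_phi_le hconv hvlim (c := fun n => phi (x n) (v n (iMax n)))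
      (Eventually.of_forall fun n => Or.inr ((hyv n _).2 _ (hxC n))) ?_
    have := tendsto_phi hs hp hvlim
    rwa [phi_self] at this
  have hy : ∀ i, Tendsto (fun n => y n i) atTop (𝓝 p) := fun i => by
    refine tendsto_of_norm_sub_le hp (Eventually.of_forall fun n => h.iMax_max n i) ?_
    simpa using (hybar.sub hp).norm
  refine ⟨⟨mem_iInter.2 fun i => ?_, mem_iInter.2 fun j => ?_⟩, mem_iInter.2 fun k => ?_⟩
  · exact (hA i).mem_VI_of_tendsto hs hC hα hxC hpC hp (hy i) ha (fun n => (hlam n).1)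
      fun n => h.y_eq n i
  · exact mem_Fix_of_tendsto (hS j).mapsTo (hSL j) (fun n => (hyv n (iMax n)).1) hpC hybar (hSy j)
  · exact (hf k).mem_EP_of_tendsto hs hC hpC (hu k) hz hd hr fun n => h.u_eq n k

end Main

end HybridMethod

theorem theorem3p2 {E : Type*} [NormedAddCommGroup E] [NormedSpace ℝ E] [CompleteSpace E]
    (hsmooth : IsUniformlySmooth E) (hconv : IsTwoUniformlyConvex E)
    (C : Set E) (hCne : C.Nonempty) (hCclosed : IsClosed C) (hCconvex : Convex ℝ C)
    (M N K : ℕ) (hM : 1 ≤ M) (hN : 1 ≤ N) (hK : 1 ≤ K)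
    (α : ℝ) (hα : 0 < α)
    (A : Fin M → E → StrongDual ℝ E) (hA : ∀ i, CondV (A i) C α)
    (f : Fin K → E → E → ℝ) (hf : ∀ k, CondA (f k) C)
    (S : Fin N → E → E) (kn : ℕ → ℝ) (L : ℝ) (hL : 0 < L)
    (hSL : ∀ j, UniformlyLipschitz (S j) C L)
    (hS : ∀ j, QuasiPhiAsymptoticallyNonexpansive (S j) C kn)
    (hFne : (commonSolutions C A S f).Nonempty)
    (ω : ℝ) (hω : 0 < ω) (hFbdd : ∀ p ∈ commonSolutions C A S f, ‖p‖ ≤ ω)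
    (w : ℕ → Fin (N + 1) → ℝ) (hw01 : ∀ n j, w n j ∈ Set.Icc (0 : ℝ) 1)
    (hwsum : ∀ n, ∑ j, w n j = 1)
    (hwliminf : ∀ j : Fin N, 0 < Filter.liminf (fun n => w n 0 * w n j.succ) Filter.atTop)
    (a b : ℝ) (ha : a ∈ Set.Ioo 0 (α * convexityParameter E ^ 2 / 2))
    (hb : b ∈ Set.Ioo 0 (α * convexityParameter E ^ 2 / 2))
    (lam : ℕ → ℝ) (hlam : ∀ n, lam n ∈ Set.Icc a b)
    (d : ℝ) (hd : 0 < d) (r : ℕ → ℝ) (hr : ∀ n, d ≤ r n)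
    (x₀ : E) (hx₀ : x₀ ∈ C) :
    (∃ x : ℕ → E, GeneratedByMethodB C A S f kn ω lam r w x₀ x) ∧
    ∃ p : E, (IsGenProj (commonSolutions C A S f) x₀ p ∧
        ∀ q, IsGenProj (commonSolutions C A S f) x₀ q → q = p) ∧
      ∀ x : ℕ → E, GeneratedByMethodB C A S f kn ω lam r w x₀ x →
        Filter.Tendsto x Filter.atTop (𝓝 p) := by
  obtain ⟨hc0, hcJ⟩ := convexityParameter_spec hconv
  set c := convexityParameter E
  have hlampos : ∀ n, 0 < lam n := fun n => ha.1.trans_le (hlam n).1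
  have hrpos : ∀ n, 0 < r n := fun n => hd.trans_le (hr n)
  have hkn : ∀ n, 1 ≤ kn n := (hS ⟨0, hN⟩).one_le
  have hgap : 0 < α - 2 * b / c ^ 2 := by
    have h1 := hb.2
    rw [sub_pos, div_lt_iff₀ (by positivity)]
    linarith
  have hβ : 0 < 2 * a * (α - 2 * b / c ^ 2) := mul_pos (by linarith [ha.1]) hgap
  have hβle : ∀ n, 2 * a * (α - 2 * b / c ^ 2) ≤ 2 * lam n * (α - 2 * lam n / c ^ 2) := fun n => by
    have h1 : 2 * lam n / c ^ 2 ≤ 2 * b / c ^ 2 := by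
      gcongr; exact (hlam n).2
    have h2 := (hlam n).1
    have h3 := hlampos n
    gcongr
  have hest : ∀ n x y i₀ z u k₀, x ∈ C → IsStep C A S f n (lam n) (r n) (w n) x y i₀ z u k₀ →
      ∀ p ∈ commonSolutions C A S f, _ := fun n x y i₀ z u k₀ hx hstep p hp =>
    hstep.phi_estimate hsmooth hCconvex hcJ hA hf hkn hS (fun j => (hw01 n j).1) (hwsum n)
      (hlampos n) hβ.le (hβle n) (hrpos n) hx hp (hFbdd p hp)
  have hFD : ∀ n x y i₀ z u k₀, x ∈ C → IsStep C A S f n (lam n) (r n) (w n) x y i₀ z u k₀ →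
      ∀ p ∈ commonSolutions C A S f, phi p (u k₀) ≤ phi p x + (kn n - 1) * (ω + ‖x‖) ^ 2 := by
    intro n x y i₀ z u k₀ hx hstep p hp
    have h1 := hest n x y i₀ z u k₀ hx hstep p hp
    have h2 := phi_nonneg (u k₀) z
    have h3 : 0 ≤ ∑ j : Fin N, w n j.succ * phi z ((S j)^[n] (y i₀)) :=
      Finset.sum_nonneg fun j _ => mul_nonneg (hw01 n _).1 (phi_nonneg _ _)
    have h4 : 0 ≤ (1 - w n 0) * (2 * a * (α - 2 * b / c ^ 2) * ‖A i₀ x - A i₀ p‖ ^ 2) :=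
      mul_nonneg (sub_nonneg.2 (hw01 n 0).2) (by positivity)
    linarith
  have hFC : commonSolutions C A S f ⊆ C := fun p hp => (mem_iInter.1 hp.2 ⟨0, hK⟩).1
  -- every run converges to a generalized projection that is unique
  have hrun : ∀ x, GeneratedByMethodB C A S f kn ω lam r w x₀ x → ∃ p, Tendsto x atTop (𝓝 p) ∧
      IsGenProj (commonSolutions C A S f) x₀ p ∧
        ∀ q, IsGenProj (commonSolutions C A S f) x₀ q → q = p := by
    rintro x ⟨y, iMax, z, u, kMax, D, h⟩
    have hxC : ∀ n, x n ∈ C := fun n => by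
      have := h.antitone (Nat.zero_le n) (h.isGenProj hx₀ n).1
      rwa [h.D_zero] at this
    have hsub : commonSolutions C A S f ⊆ ⋂ n, D n := by
      refine fun p hp => mem_iInter.2 fun n => ?_
      induction n with
      | zero => rw [h.D_zero]; exact hFC hp
      | succ n ih =>
        rw [h.D_succ n]
        exact ⟨ih, hFD n _ _ _ _ _ _ (hxC n) (h.isStep n) p hp⟩
    obtain ⟨p, hp, hproj⟩ := h.exists_tendsto hsmooth hconv hCclosed hCconvex hx₀ (hFne.mono hsub)
    obtain ⟨p₀, hp₀⟩ := hFne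
    have hpF : p ∈ commonSolutions C A S f :=
      h.limit_mem_commonSolutions hsmooth hconv hCclosed hCconvex hN hα hA hf hSL hS hw01 hwsum
        hwliminf hcJ ha.1 hlam hβ hd hr hx₀ hp₀
        (fun n => hest n _ _ _ _ _ _ (hxC n) (h.isStep n) p₀ hp₀) hp
    refine ⟨p, hp, ⟨hpF, fun q hq => hproj.2 q (hsub hq)⟩, fun q hq => ?_⟩
    -- the common solutions lie in the convex intersection of the sets of the run, onto which `p`
    -- is the projection
    obtain ⟨ν, hν, hgrow⟩ := exists_quadratic_growth_phi hconv
    have h1 := hgrow _ _ _ (convex_iInter fun n => (h.isClosed_convex hCclosed hCconvex n).2)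
      hproj q (hsub hq.1)
    have h2 := hq.2 p hpF
    have h3 : ‖q - p‖ ^ 2 ≤ 0 := by
      by_contra hcon
      have := mul_pos hν (not_le.1 hcon)
      linarith
    rwa [sq_nonpos_iff, norm_eq_zero, sub_eq_zero] at h3
  obtain ⟨x, hx⟩ := exists_isMethodBRun hsmooth hconv hCclosed hCconvex hM hK hf hFne hFC hrpos hFD
    hx₀
  obtain ⟨p, -, hpF, hpuniq⟩ := hrun x hx
  refine ⟨⟨x, hx⟩, p, ⟨hpF, hpuniq⟩, fun x' hx' => ?_⟩
  obtain ⟨p', hp', hpF', -⟩ := hrun x' hx'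
  rwa [hpuniq p' hpF'] at hp'
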